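/- **Corollary (Frobenius risk of orthogonally invariant estimators).** Let $n,p$ be natural numbers with $p\le n+1$, let $M\in\mathbb R^{n\times p}$, and let $X\in\mathbb R^{n\times p}$ have independent entries $X_{ai}\sim N(M_{ai},1)$; write $\mathrm E_M$ for the expectation. Let $\lambda=\lambda(X)=(\lambda_1\ge\dots\ge\lambda_p)$ be the eigenvalues of $X^\top X$ and let $(\widetilde\nabla h(X))_{ai}=\partial h(X)/\partial X_{ai}$ be the matrix gradient (an entry being read as $0$ where the partial derivative does not exist). Let $h:\mathbb R^{n\times p}\to\mathbb R$ be orthogonally invariant, i.e. $h(PXQ)=h(X)$ for all orthogonal $P\in O(n)$, $Q\in O(p)$, and let $H:\mathbb R^p\to\mathbb R$ satisfy $h(X)=H(\lambda(X))$ for all $X$. Assume that $H$ is $C^2$ in a neighbourhood of $\lambda(X)$ for Lebesgue-almost every $X$, that $\widetilde\nabla h$ is weakly differentiable on $\mathbb R^{n\times p}$ (each entry is locally integrable and has locally integrable first-order distributional partial derivatives), and that, with $H_k=\partial H/\partial\lambda_k$ and $H_{kk}=\partial^2H/\partial\lambda_k^2$ evaluated at $\lambda$, the random variables $\|\widetilde\nabla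 h(X)\|_{\mathrm F}^2$ and $$\sum_k\left(2\lambda_kH_{kk}+nH_k+\lambda_kH_k^2\right)+\sum_kH_k\sum_{l\ne k}\frac{\lambda_k+\lambda_l}{\lambda_k-\lambda_l}$$ are integrable under $\mathrm E_M$. (The $\lambda_k$ are almost surely distinct.) Then the estimator $\hat M=X+\widetilde\nabla h(X)$ has finite Frobenius risk, the random variables in both expectations below are integrable, and $$\begin{aligned}\mathrm E_M\|\hat M-M\|_{\mathrm F}^2&=np+4\,\mathrm E_M\left[\sum_k\left(2\lambda_kH_{kk}+nH_k+\lambda_kH_k^2\right)+\sum_kH_k\sum_{l\ne k}\frac{\lambda_k+\lambda_l}{\lambda_k-\lambda_l}\right]\\&=np+4\,\mathrm E_M\left[\sum_k\left(2\lambda_kH_{kk}+nH_k+\lambda_kH_k^2\right)+\sum_kH_k\left(2\lambda_k\sum_{l\ne k}\frac1{\lambda_k-\lambda_l}-p+1\right)\right].\end{aligned}$$ -/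

import Mathlib

open MeasureTheory ProbabilityTheory

open scoped ContDiff

namespace MatrixRisk

noncomputable section

/-- Real `n × p` matrices as a function space, carrying its product topology and Lebesgue measure. -/
abbrev Mat (n p : ℕ) : Type := Fin n → Fin p → ℝ

/-- The matrix unit with a `1` in position `(a, i)`. -/
def unitMat {n p : ℕ} (a : Fin n) (i : Fin p) : Mat n p := Pi.single a (Pi.single i 1)

/-- The law of a random `n × p` matrix whose entries are independent with
`X a i` distributed as `N(M a i, 1)`. -/
def gaussianMat {n p : ℕ} (M : Mat n p) : Measure (Mat n p) :=
  Measure.pi fun a => Measure.pi fun i => gaussianReal (M a i) 1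

/-- The squared Frobenius norm. -/
def frobSq {n p : ℕ} (A : Mat n p) : ℝ := ∑ a, ∑ i, A a i ^ 2

theorem isHermitian_gram {n p : ℕ} (X : Mat n p) :
    ((Matrix.of X).transpose * Matrix.of X).IsHermitian := by
  rw [← Matrix.conjTranspose_eq_transpose_of_trivial]
  exact Matrix.isHermitian_conjTranspose_mul_self _

/-- The eigenvalues of `Xᵀ X`, with multiplicity, in decreasing order
`eigs X 0 ≥ eigs X 1 ≥ ...`. -/
def eigs {n p : ℕ} (X : Mat n p) : Fin p → ℝ := fun k =>
  (isHermitian_gram X).eigenvalues₀ (Fin.cast (Fintype.card_fin p).symm k)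

/-- `h (P X Q) = h X` for all orthogonal `P` and `Q`. -/
def IsOrthInvariant {n p : ℕ} (h : Mat n p → ℝ) : Prop :=
  ∀ P ∈ Matrix.orthogonalGroup (Fin n) ℝ, ∀ Q ∈ Matrix.orthogonalGroup (Fin p) ℝ,
    ∀ X : Mat n p, h (Matrix.of.symm (P * Matrix.of X * Q)) = h X

/-- The matrix gradient: the matrix of the partial derivatives of `f` in the entries of `X`. -/
def matGrad {n p : ℕ} (f : Mat n p → ℝ) (X : Mat n p) : Mat n p :=
  fun a i => lineDeriv ℝ f X (unitMat a i)

/-- `f` is weakly differentiable on the whole matrix space: `f` is locally integrable and each of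
its first order distributional partial derivatives is a locally integrable function. -/
def WeaklyDifferentiable {n p : ℕ} (f : Mat n p → ℝ) : Prop :=
  LocallyIntegrable f volume ∧
    ∀ (a : Fin n) (i : Fin p), ∃ f' : Mat n p → ℝ, LocallyIntegrable f' volume ∧
      ∀ φ : Mat n p → ℝ, ContDiff ℝ ∞ φ → HasCompactSupport φ →
        ∫ X, f X * lineDeriv ℝ φ X (unitMat a i) = - ∫ X, f' X * φ X

/-- The partial derivative of `H` in its `k`-th variable. -/
def pd {p : ℕ} (H : (Fin p → ℝ) → ℝ) (k : Fin p) : (Fin p → ℝ) → ℝ :=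
  fun μ => lineDeriv ℝ H μ (Pi.single k 1)

/-- `∑ k, (2 λ_k ∂²H/∂λ_k² + n ∂H/∂λ_k + λ_k (∂H/∂λ_k)²)` at the point `μ` for `λ`. -/
def mainTerm {p : ℕ} (n : ℕ) (H : (Fin p → ℝ) → ℝ) (μ : Fin p → ℝ) : ℝ :=
  ∑ k, (2 * μ k * pd (pd H k) k μ + n * pd H k μ + μ k * pd H k μ ^ 2)

/-- `∑ k, ∂H/∂λ_k ∑_{l ≠ k} (λ_k + λ_l) / (λ_k - λ_l)` at the point `μ` for `λ`. -/
def crossTerm {p : ℕ} (H : (Fin p → ℝ) → ℝ) (μ : Fin p → ℝ) : ℝ :=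
  ∑ k, pd H k μ * ∑ l ∈ Finset.univ.erase k, (μ k + μ l) / (μ k - μ l)

/-- `∑ k, ∂H/∂λ_k (2 λ_k ∑_{l ≠ k} 1 / (λ_k - λ_l) - p + 1)` at the point `μ` for `λ`. -/
def crossTerm' {p : ℕ} (H : (Fin p → ℝ) → ℝ) (μ : Fin p → ℝ) : ℝ :=
  ∑ k, pd H k μ * (2 * μ k * ∑ l ∈ Finset.univ.erase k, 1 / (μ k - μ l) - p + 1)

end

end MatrixRisk

/-!
The risk formula is Stein's unbiased risk estimate for `X + G X` with `G = matGrad h`, combined with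
a computation of the Laplacian of `h = H ∘ eigs`.

*Perturbation of eigenvalues.* Where the eigenvalues `λ_k` of `Xᵀ X` are simple, the implicit
function theorem applied to the equations `Xᵀ X v = t v`, `v ⬝ v = 1` gives `C²` branches of
eigenpairs (`exists_smooth_eigenpair`). The branches keep their strict order near `X`, so they are
`eigs` together with an orthonormal frame `V k` (`exists_isSmoothFrameAt`). Differentiating
`(X V k) ⬝ (X w) = λ_k (V k ⬝ w)` with `w` fixed, and then setting `w = V l`, yields the gradient
`2 X (V k) (V k)ᵀ` of `λ_k` (`IsSmoothFrameAt.hasLineDerivAt_eigs`) and the coordinates of the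
derivative of `V k` in the frame (`IsSmoothFrameAt.lineDeriv_vec`). Summing over the entries of `X`,
with `V k ⬝ V l = δ_kl` and `(X V k) ⬝ (X V l) = δ_kl λ_k`, gives
`|∇h|² = 4 ∑ λ_k H_k²` and
`Δh = ∑ (4 λ_k H_kk + 2 n H_k + 2 H_k ∑_{l ≠ k} (λ_k + λ_l) / (λ_k - λ_l))`, so that
`2 Δh + |∇h|²` is four times the integrand of the theorem; here `H_k` and `H_kk` are the partial
derivatives of `H` at `eigs X` (`two_mul_sum_lineDeriv_add_frobSq`).
An eigenvalue that vanishes identically, which occurs for `p = n + 1`, needs no separate treatment.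

*Simplicity almost everywhere.* The discriminant of the characteristic polynomial of `Xᵀ X` is the
Hankel determinant of the power sums `tr (Xᵀ X) ^ (i + j)`. It is a homogeneous polynomial in `X`
that is nonzero somewhere when `p ≤ n + 1`, so its zero set is null (`ae_injective_eigs`).

*Stein's identity.* On the open set of full measure where the eigenvalues are simple and `H` is
`C²`, the weak derivatives of `G` are the classical ones (`ae_eq_lineDeriv_of_weak`). Hence the weak
divergence of `G` is almost everywhere `Δh`, which is integrable because `2 Δh + |∇h|²` and `|∇h|²`
are. Testing the weak derivatives against a smooth cutoff times the Gaussian density and removing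
the cutoff gives `E ⟪G, X - M⟫ = E div G` (`stein_identity`).
-/

namespace MatrixRisk

open Filter

open scoped Matrix Topology

/-! ### Eigenframes of the Gram matrix -/

/-- The Gram matrix `Xᵀ X`. -/
def gram {n p : ℕ} (X : Mat n p) : Matrix (Fin p) (Fin p) ℝ :=
  (Matrix.of X).transpose * Matrix.of X

/-- An orthonormal family of eigenvectors of `Xᵀ X`, the `k`-th of which belongs to `eigs X k`. -/
structure IsEigenframe {n p : ℕ} (X : Mat n p) (V : Fin p → Fin p → ℝ) : Prop where
  orthonormal : ∀ k l, V k ⬝ᵥ V l = if k = l then 1 else 0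
  eigen : ∀ k, gram X *ᵥ V k = eigs X k • V k

theorem eigs_antitone {n p : ℕ} (X : Mat n p) : Antitone (eigs X) := fun _ _ hij =>
  (isHermitian_gram X).eigenvalues₀_antitone hij

theorem exists_isEigenframe {n p : ℕ} (X : Mat n p) : ∃ V, IsEigenframe X V := by
  let e : Fin p ≃ Fin p :=
    (finCongr (Fintype.card_fin p).symm).trans (Fintype.equivOfCardEq (Fintype.card_fin _))
  refine ⟨fun k => ⇑((isHermitian_gram X).eigenvectorBasis (e k)), fun k l => ?_, fun k => ?_⟩
  · have := orthonormal_iff_ite.1 (isHermitian_gram X).eigenvectorBasis.orthonormal (e l) (e k)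
    rw [EuclideanSpace.inner_eq_star_dotProduct] at this
    simpa [e.injective.eq_iff, eq_comm] using this
  · have := (isHermitian_gram X).mulVec_eigenvectorBasis (e k)
    rw [gram, this]
    simp [Matrix.IsHermitian.eigenvalues, e, eigs]

theorem gram_dotProduct {n p : ℕ} (X : Mat n p) (v w : Fin p → ℝ) :
    (gram X *ᵥ v) ⬝ᵥ w = (Matrix.of X *ᵥ v) ⬝ᵥ (Matrix.of X *ᵥ w) := by
  rw [gram, ← Matrix.mulVec_mulVec, Matrix.mulVec_transpose, ← Matrix.dotProduct_mulVec]

/-- A square matrix with orthonormal rows has orthonormal columns. -/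
theorem sum_mul_eq_ite_of_orthonormal {p : ℕ} {V : Fin p → Fin p → ℝ}
    (hV : ∀ k l, V k ⬝ᵥ V l = if k = l then 1 else 0) (i j : Fin p) :
    ∑ k, V k i * V k j = if i = j then 1 else 0 := by
  have h1 : Matrix.of V * (Matrix.of V)ᵀ = 1 := by
    ext k l
    simpa [Matrix.mul_apply, Matrix.one_apply, dotProduct] using hV k l
  have h2 := congrArg (fun B => B i j) (mul_eq_one_comm.1 h1)
  simpa [Matrix.mul_apply, Matrix.one_apply] using h2

theorem eq_sum_of_orthonormal {p : ℕ} {V : Fin p → Fin p → ℝ}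
    (hV : ∀ k l, V k ⬝ᵥ V l = if k = l then 1 else 0) (w : Fin p → ℝ) (i : Fin p) :
    w i = ∑ k, (w ⬝ᵥ V k) * V k i := by
  simp_rw [dotProduct, Finset.sum_mul, mul_assoc]
  rw [Finset.sum_comm]
  simp_rw [← Finset.mul_sum, sum_mul_eq_ite_of_orthonormal hV]
  simp

/-- `p` distinct eigenvalues of `Xᵀ X`, listed in decreasing order, are `eigs X`. -/
theorem eigs_eq_of_strictAnti {n p : ℕ} {X : Mat n p} {L : Fin p → ℝ} (hL : StrictAnti L)
    (h : ∀ k, ∃ v, v ≠ 0 ∧ gram X *ᵥ v = L k • v) : eigs X = L := by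
  obtain ⟨V, hV⟩ := exists_isEigenframe X
  have hsub : Set.range L ⊆ Set.range (eigs X) := by
    rintro _ ⟨k, rfl⟩
    obtain ⟨v, hv0, hv⟩ := h k
    by_contra hk
    refine hv0 (funext fun i => ?_)
    rw [eq_sum_of_orthonormal hV.orthonormal v i]
    refine Finset.sum_eq_zero fun l _ => ?_
    have h1 : (gram X *ᵥ v) ⬝ᵥ V l = (gram X *ᵥ V l) ⬝ᵥ v := by
      rw [gram_dotProduct, gram_dotProduct, dotProduct_comm]
    rw [hv, hV.eigen, smul_dotProduct, smul_dotProduct, dotProduct_comm (V l), smul_eq_mul,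
      smul_eq_mul] at h1
    have h2 : L k ≠ eigs X l := fun h => hk ⟨l, h.symm⟩
    have h3 : (L k - eigs X l) * (v ⬝ᵥ V l) = 0 := by linear_combination h1
    rw [(mul_eq_zero.1 h3).resolve_left (sub_ne_zero.2 h2), zero_mul]
  have hfin : (Set.range (eigs X)).Finite := Set.finite_range _
  have hcardL : (Set.range L).ncard = p := by
    rw [← Set.image_univ, Set.ncard_image_of_injective _ hL.injective]; simp
  have hcardE : (Set.range (eigs X)).ncard ≤ p := by
    rw [← Set.image_univ]
    exact (Set.ncard_image_le Set.finite_univ).trans (by simp)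
  have heq : Set.range L = Set.range (eigs X) :=
    Set.eq_of_subset_of_ncard_le hsub (by omega) hfin
  have hinj : Function.Injective (eigs X) := by
    rw [← Set.injOn_univ, ← Set.ncard_image_iff Set.finite_univ, Set.image_univ, ← heq, hcardL]
    simp
  exact (((eigs_antitone X).strictAnti_of_injective hinj).range_inj hL).1 heq.symm

/-! ### Almost every Gram matrix has simple spectrum -/

/-- The Hankel determinant of the power sums `tr A ^ (i + j)`: the discriminant of the
characteristic polynomial of `A`. -/
def hankelDet {p : ℕ} {R : Type*} [CommRing R] (A : Matrix (Fin p) (Fin p) R) : R :=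
  (Matrix.of fun i j : Fin p => (A ^ (i.1 + j.1)).trace).det

theorem hankelDet_map {p : ℕ} {R S : Type*} [CommRing R] [CommRing S] (f : R →+* S)
    (A : Matrix (Fin p) (Fin p) R) : f (hankelDet A) = hankelDet (A.map f) := by
  rw [hankelDet, hankelDet, RingHom.map_det]
  congr 1
  ext i j
  simp only [RingHom.mapMatrix_apply, Matrix.map_apply, Matrix.of_apply]
  rw [AddMonoidHom.map_trace f, ← RingHom.mapMatrix_apply, ← RingHom.mapMatrix_apply, map_pow]

theorem hankelDet_smul {p : ℕ} (c : ℝ) (A : Matrix (Fin p) (Fin p) ℝ) :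
    hankelDet (c • A) = (∏ i : Fin p, c ^ i.1) * ((∏ i : Fin p, c ^ i.1) * hankelDet A) := by
  rw [hankelDet, hankelDet, ← Matrix.det_mul_row, ← Matrix.det_mul_column]
  congr 1
  ext i j
  simp only [Matrix.of_apply, smul_pow, Matrix.trace_smul, smul_eq_mul]
  ring

/-- With respect to an eigenbasis the power sums are `∑ k, d k ^ (i + j)`, so that the Hankel matrix
is the Gram matrix of the Vandermonde matrix of the eigenvalues. -/
theorem hankelDet_eq_sq {p : ℕ} {A : Matrix (Fin p) (Fin p) ℝ} {d : Fin p → ℝ}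
    {V : Fin p → Fin p → ℝ} (hV : ∀ k l, V k ⬝ᵥ V l = if k = l then 1 else 0)
    (hA : ∀ k, A *ᵥ V k = d k • V k) :
    hankelDet A = (Matrix.vandermonde d).det ^ 2 := by
  have hpow : ∀ (m : ℕ) (k : Fin p), (A ^ m) *ᵥ V k = d k ^ m • V k := by
    intro m k
    induction m with
    | zero => simp
    | succ m ih => rw [pow_succ, ← Matrix.mulVec_mulVec, hA, Matrix.mulVec_smul, ih, smul_smul,
        pow_succ']
  have htr : ∀ m : ℕ, (A ^ m).trace = ∑ k, d k ^ m := by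
    intro m
    have h1 : ∀ i, (A ^ m) i i = ∑ k, V k i * ((A ^ m) *ᵥ V k) i := by
      intro i
      simp_rw [Matrix.mulVec, dotProduct, Finset.mul_sum]
      rw [Finset.sum_comm]
      have : ∀ j, ∑ k, V k i * ((A ^ m) i j * V k j) = (A ^ m) i j * if i = j then 1 else 0 := by
        intro j
        rw [← sum_mul_eq_ite_of_orthonormal hV i j, Finset.mul_sum]
        exact Finset.sum_congr rfl fun k _ => by ring
      simp [this]
    simp_rw [Matrix.trace, Matrix.diag, h1, hpow]
    rw [Finset.sum_comm]
    refine Finset.sum_congr rfl fun k _ => ?_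
    have h2 := hV k k
    rw [if_pos rfl, dotProduct] at h2
    calc ∑ i, V k i * (d k ^ m • V k) i = d k ^ m * ∑ i, V k i * V k i := by
          rw [Finset.mul_sum]
          exact Finset.sum_congr rfl fun i _ => by rw [Pi.smul_apply, smul_eq_mul]; ring
      _ = d k ^ m := by rw [h2, mul_one]
  have : (Matrix.of fun i j : Fin p => (A ^ (i.1 + j.1)).trace)
      = (Matrix.vandermonde d)ᵀ * Matrix.vandermonde d := by
    ext i j
    rw [Matrix.of_apply, htr, Matrix.mul_apply]
    exact Finset.sum_congr rfl fun k _ => pow_add _ _ _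
  rw [hankelDet, this, Matrix.det_mul, Matrix.det_transpose, sq]

theorem eigs_injective_iff {n p : ℕ} (X : Mat n p) :
    Function.Injective (eigs X) ↔ hankelDet (gram X) ≠ 0 := by
  obtain ⟨V, hV⟩ := exists_isEigenframe X
  rw [hankelDet_eq_sq hV.orthonormal hV.eigen, pow_ne_zero_iff two_ne_zero,
    Matrix.det_vandermonde_ne_zero_iff]

/-- For `p ≤ n + 1` some `n × p` matrix has a Gram matrix with distinct eigenvalues: the matrix with
`1, 2, 3, …` on its diagonal. When `p = n + 1`, the last eigenvalue is `0`. -/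
theorem exists_hankelDet_gram_ne_zero {n p : ℕ} (hnp : p ≤ n + 1) :
    ∃ Y : Mat n p, hankelDet (gram Y) ≠ 0 := by
  let d : Fin p → ℝ := fun i => if i.1 < n then ((i.1 : ℝ) + 1) ^ 2 else 0
  refine ⟨fun a i => if a.1 = i.1 then (i.1 : ℝ) + 1 else 0, ?_⟩
  rw [hankelDet_eq_sq (d := d) (V := fun k => Pi.single k 1), pow_ne_zero_iff two_ne_zero,
    Matrix.det_vandermonde_ne_zero_iff]
  · intro i j hij
    simp only [d] at hij
    ext
    split_ifs at hij with h1 h2 h2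
    · have := (sq_eq_sq₀ (by positivity) (by positivity)).1 hij
      exact_mod_cast add_right_cancel this
    · have : (0 : ℝ) < ((i.1 : ℝ) + 1) ^ 2 := by positivity
      linarith
    · have : (0 : ℝ) < ((j.1 : ℝ) + 1) ^ 2 := by positivity
      linarith
    · omega
  · intro k l
    simp [Pi.single_apply, eq_comm]
  · intro k
    ext j
    simp only [gram, Matrix.mulVec_single_one, Matrix.col_apply, Matrix.mul_apply,
      Matrix.transpose_apply, Matrix.of_apply, Pi.smul_apply, smul_eq_mul, d]
    by_cases hk : k.1 < n
    · rw [Finset.sum_eq_single ⟨k.1, hk⟩]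
      · by_cases hjk : j = k
        · subst hjk; simp [hk]; ring
        · have : ¬ k.1 = j.1 := fun h => hjk (Fin.ext h.symm)
          simp [this, hjk]
      · intro b _ hb
        have : ¬ b.1 = k.1 := fun h => hb (Fin.ext h)
        simp [this]
      · simp
    · rw [if_neg hk, zero_mul]
      refine Finset.sum_eq_zero fun b _ => ?_
      have : ¬ b.1 = k.1 := by omega
      simp [this]

theorem gram_smul {n p : ℕ} (c : ℝ) (X : Mat n p) : gram (c • X) = c ^ 2 • gram X := by
  ext i j
  simp only [gram, Matrix.mul_apply, Matrix.transpose_apply, Matrix.of_apply, Pi.smul_apply,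
    smul_eq_mul, Matrix.smul_apply, Finset.mul_sum]
  exact Finset.sum_congr rfl fun a _ => by ring

theorem continuous_hankelDet_gram {n p : ℕ} :
    Continuous fun X : Mat n p => hankelDet (gram X) := by
  have h : Continuous fun X : Mat n p => gram X := by
    unfold gram
    exact (continuous_id.matrix_transpose).matrix_mul continuous_id
  unfold hankelDet
  refine Continuous.matrix_det (continuous_matrix fun i j => ?_)
  exact Continuous.matrix_trace (h.pow _)

/-- The discriminant is homogeneous in `X`, so on each line with direction `Y`, where `Y` has
nonzero discriminant, it vanishes only at finitely many points; Fubini's theorem concludes. -/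
theorem ae_injective_eigs {n p : ℕ} (hnp : p ≤ n + 1) :
    ∀ᵐ X : Mat n p, Function.Injective (eigs X) := by
  obtain ⟨Y, hY⟩ := exists_hankelDet_gram_ne_zero hnp
  simp_rw [eigs_injective_iff]
  refine ae_mem_of_ae_add_linearMap_mem (LinearMap.toSpanSingleton ℝ (Mat n p) Y) volume volume
    (s := {X | hankelDet (gram X) ≠ 0})
    (isOpen_ne_fun continuous_hankelDet_gram continuous_const).measurableSet fun X => ?_
  -- the discriminant along the line through `Y` in direction `X`, as a polynomial
  let P : Matrix (Fin n) (Fin p) (Polynomial ℝ) :=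
    Matrix.of fun a i => Polynomial.X * Polynomial.C (X a i) + Polynomial.C (Y a i)
  let Q : Polynomial ℝ := hankelDet (Pᵀ * P)
  have hQ : ∀ s : ℝ, Q.eval s = hankelDet (gram (s • X + Y)) := by
    intro s
    rw [← Polynomial.coe_evalRingHom, hankelDet_map]
    congr 1
    ext i j
    simp [P, gram, Matrix.mul_apply, Polynomial.eval_finsetSum, mul_comm s]
  have hQ0 : Q ≠ 0 := by
    intro h
    have := hQ 0
    rw [h] at this
    simp at this
    exact hY this.symm
  have hfin : (insert 0 (Inv.inv ⁻¹' {s : ℝ | Q.IsRoot s})).Finite :=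
    ((Polynomial.finite_setOfPred_isRoot hQ0).preimage inv_injective.injOn).insert 0
  filter_upwards [hfin.countable.ae_notMem volume] with t ht
  simp only [Set.mem_insert_iff, Set.mem_preimage, Set.mem_ofPred_eq, not_or, Polynomial.IsRoot.def,
    hQ] at ht
  obtain ⟨ht0, ht1⟩ := ht
  -- by homogeneity, zeros `t ≠ 0` on the line correspond to the zeros `t⁻¹` of `Q`
  have h1 : X + t • Y = t • (t⁻¹ • X + Y) := by
    rw [smul_add, smul_smul, mul_inv_cancel₀ ht0, one_smul]
  simp only [LinearMap.toSpanSingleton_apply, h1, gram_smul, hankelDet_smul]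
  have h2 : (∏ i : Fin p, (t ^ 2) ^ i.1) ≠ 0 :=
    Finset.prod_ne_zero_iff.2 fun i _ => pow_ne_zero _ (pow_ne_zero _ ht0)
  exact mul_ne_zero h2 (mul_ne_zero h2 ht1)

/-! ### Smooth branches of eigenpairs -/

/-- The equation of a normalised eigenpair `(v, t)` of `Xᵀ X`: its solutions are the zeros of the
first component at which the second component is `1`. -/
def eigenEq {n p : ℕ} (u : Mat n p × ((Fin p → ℝ) × ℝ)) : (Fin p → ℝ) × ℝ :=
  (gram u.1 *ᵥ u.2.1 - u.2.2 • u.2.1, u.2.1 ⬝ᵥ u.2.1)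

theorem contDiff_eigenEq {n p : ℕ} : ContDiff ℝ 2 (eigenEq (n := n) (p := p)) := by
  refine ContDiff.prodMk (contDiff_pi.2 fun i => ?_) ?_
  · simp only [gram, Matrix.mulVec, dotProduct, Matrix.mul_apply, Matrix.transpose_apply,
      Matrix.of_apply, Pi.sub_apply, Pi.smul_apply, smul_eq_mul]
    fun_prop
  · simp only [dotProduct]
    fun_prop

theorem fderiv_eigenEq_inr {n p : ℕ} (X : Mat n p) (v w : Fin p → ℝ) (t s : ℝ) :
    fderiv ℝ eigenEq (X, (v, t)) (0, (w, s)) =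
      (gram X *ᵥ w - t • w - s • v, 2 * (v ⬝ᵥ w)) := by
  have h1 := ((contDiff_eigenEq (n := n) (p := p)).differentiable two_ne_zero
    (X, (v, t))).hasFDerivAt.hasLineDerivAt (0, (w, s))
  refine h1.unique ?_
  have h2 : ∀ r : ℝ, eigenEq ((X, (v, t)) + r • ((0 : Mat n p), (w, s))) =
      eigenEq (X, (v, t)) + (r • (gram X *ᵥ w - t • w - s • v, 2 * (v ⬝ᵥ w))
        + r ^ 2 • (-(s • w), w ⬝ᵥ w)) := by
    intro r
    ext i
    · simp [eigenEq, Matrix.mulVec_add, Matrix.mulVec_smul]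
      ring
    · simp [eigenEq, dotProduct_comm w v]
      ring
  unfold HasLineDerivAt
  simp_rw [h2]
  have h3 := ((hasDerivAt_id (0 : ℝ)).smul_const
    (gram X *ᵥ w - t • w - s • v, 2 * (v ⬝ᵥ w))).add
    (((hasDerivAt_id (0 : ℝ)).pow 2).smul_const (-(s • w), w ⬝ᵥ w))
  have h4 := h3.const_add (eigenEq (X, (v, t)))
  simpa using h4

/-- At a simple eigenvalue the eigenpair equation is nondegenerate in the eigenpair. -/
theorem isInvertible_fderiv_eigenEq {n p : ℕ} {X : Mat n p} {V : Fin p → Fin p → ℝ}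
    (hV : IsEigenframe X V) (hinj : Function.Injective (eigs X)) (k : Fin p) :
    (fderiv ℝ eigenEq (X, (V k, eigs X k)) ∘L
      ContinuousLinearMap.inr ℝ (Mat n p) ((Fin p → ℝ) × ℝ)).IsInvertible := by
  set A := fderiv ℝ eigenEq (X, (V k, eigs X k)) ∘L
      ContinuousLinearMap.inr ℝ (Mat n p) ((Fin p → ℝ) × ℝ) with hA
  have hAapp : ∀ w s, A (w, s) =
      (gram X *ᵥ w - eigs X k • w - s • V k, 2 * (V k ⬝ᵥ w)) := fun w s =>
    fderiv_eigenEq_inr X (V k) w (eigs X k) s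
  have hinjA : Function.Injective A := by
    rw [injective_iff_map_eq_zero]
    rintro ⟨w, s⟩ h0
    rw [hAapp, Prod.mk_eq_zero] at h0
    obtain ⟨h1, h2⟩ := h0
    have h2' : V k ⬝ᵥ w = 0 := by linarith
    -- the kernel equation paired with `V l`: `l = k` gives `s = 0`, and then `l ≠ k` gives `w = 0`
    have h3 : ∀ l, (eigs X l - eigs X k) * (w ⬝ᵥ V l) - s * (if k = l then 1 else 0) = 0 := by
      intro l
      have h4 : (gram X *ᵥ w) ⬝ᵥ V l = eigs X l * (w ⬝ᵥ V l) := by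
        rw [gram_dotProduct, dotProduct_comm, ← gram_dotProduct, hV.eigen, smul_dotProduct,
          dotProduct_comm, smul_eq_mul]
      have h5 := congrArg (fun u => u ⬝ᵥ V l) h1
      simp only [sub_dotProduct, smul_dotProduct, zero_dotProduct, h4, hV.orthonormal,
        smul_eq_mul] at h5
      linear_combination h5
    have hs : s = 0 := by
      have := h3 k
      simpa using this
    subst hs
    have hw : w = 0 := by
      funext i
      rw [eq_sum_of_orthonormal hV.orthonormal w i]
      refine Finset.sum_eq_zero fun l _ => ?_
      by_cases hl : l = k
      · subst hl
        rw [dotProduct_comm, h2', zero_mul]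
      · have := h3 l
        rw [zero_mul, sub_zero] at this
        rw [(mul_eq_zero.1 this).resolve_left (sub_ne_zero.2 fun h => hl (hinj h)), zero_mul]
    rw [hw, Prod.mk_zero_zero]
  have hsurj : Function.Surjective A :=
    (LinearMap.injective_iff_surjective (f := A.toLinearMap)).1 hinjA
  exact ⟨ContinuousLinearEquiv.ofBijective A (LinearMap.ker_eq_bot.2 hinjA)
    (LinearMap.range_eq_top.2 hsurj), ContinuousLinearEquiv.coe_ofBijective _ _ _⟩

/-- A simple eigenvalue and its normalised eigenvector extend smoothly to nearby matrices. -/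
theorem exists_smooth_eigenpair {n p : ℕ} {X : Mat n p} {V : Fin p → Fin p → ℝ}
    (hV : IsEigenframe X V) (hinj : Function.Injective (eigs X)) (k : Fin p) :
    ∃ ψ : Mat n p → (Fin p → ℝ) × ℝ, ContDiffAt ℝ 2 ψ X ∧ ψ X = (V k, eigs X k) ∧
      ∀ᶠ Y in 𝓝 X, gram Y *ᵥ (ψ Y).1 = (ψ Y).2 • (ψ Y).1 ∧ (ψ Y).1 ⬝ᵥ (ψ Y).1 = 1 := by
  have cdf : ContDiffAt ℝ 2 eigenEq (X, (V k, eigs X k)) := contDiff_eigenEq.contDiffAt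
  have hi := isInvertible_fderiv_eigenEq hV hinj k
  refine ⟨cdf.implicitFunction two_ne_zero hi, cdf.contDiffAt_implicitFunction two_ne_zero hi,
    cdf.implicitFunction_apply_self two_ne_zero hi, ?_⟩
  filter_upwards [cdf.eventually_apply_implicitFunction two_ne_zero hi] with Y hY
  simp only [eigenEq, Prod.mk.injEq, hV.eigen, sub_self, hV.orthonormal, if_true] at hY
  exact ⟨sub_eq_zero.1 hY.1, hY.2⟩

/-- `V` is a `C²` choice of eigenframes near `X`, where the eigenvalues are simple and `C²`. -/
structure IsSmoothFrameAt {n p : ℕ} (V : Mat n p → Fin p → Fin p → ℝ) (X : Mat n p) : Prop where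
  contDiffAt_vec : ∀ k i, ContDiffAt ℝ 2 (fun Y => V Y k i) X
  contDiffAt_eigs : ∀ k, ContDiffAt ℝ 2 (fun Y : Mat n p => eigs Y k) X
  eventually_injective : ∀ᶠ Y : Mat n p in 𝓝 X, Function.Injective (eigs Y)
  eventually_frame : ∀ᶠ Y in 𝓝 X, IsEigenframe Y (V Y)

theorem IsSmoothFrameAt.eventually {n p : ℕ} {V : Mat n p → Fin p → Fin p → ℝ} {X : Mat n p}
    (h : IsSmoothFrameAt V X) : ∀ᶠ Y in 𝓝 X, IsSmoothFrameAt V Y := by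
  have h1 : ∀ᶠ Y in 𝓝 X, ∀ k i, ContDiffAt ℝ 2 (fun Y => V Y k i) Y := by
    simp_rw [eventually_all]
    exact fun k i => (h.contDiffAt_vec k i).eventually (by simp)
  have h2 : ∀ᶠ Y in 𝓝 X, ∀ k, ContDiffAt ℝ 2 (fun Y : Mat n p => eigs Y k) Y := by
    simp_rw [eventually_all]
    exact fun k => (h.contDiffAt_eigs k).eventually (by simp)
  filter_upwards [h1, h2, h.eventually_injective.eventually_nhds,
    h.eventually_frame.eventually_nhds] with Y a b c d
  exact ⟨a, b, c, d⟩

theorem exists_isSmoothFrameAt {n p : ℕ} {X : Mat n p} (hinj : Function.Injective (eigs X)) :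
    ∃ V, IsSmoothFrameAt V X := by
  obtain ⟨V, hV⟩ := exists_isEigenframe X
  choose ψ hψ hψX hψe using fun k => exists_smooth_eigenpair hV hinj k
  have hanti : StrictAnti (eigs X) := (eigs_antitone X).strictAnti_of_injective hinj
  have hlt : ∀ᶠ Y in 𝓝 X, ∀ k l, k < l → (ψ l Y).2 < (ψ k Y).2 := by
    simp_rw [eventually_all]
    intro k l hkl
    have hc : ∀ k, ContinuousAt (fun Y => (ψ k Y).2) X := fun k =>
      continuousAt_snd.comp (hψ k).continuousAt
    refine (hc l).eventually_lt (hc k) ?_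
    simpa [hψX] using hanti hkl
  have hall : ∀ᶠ Y in 𝓝 X, ∀ k, gram Y *ᵥ (ψ k Y).1 = (ψ k Y).2 • (ψ k Y).1 ∧
      (ψ k Y).1 ⬝ᵥ (ψ k Y).1 = 1 := eventually_all.2 hψe
  -- the branches stay in strict order, so they are all the eigenvalues
  have hmain : ∀ᶠ Y in 𝓝 X, (eigs Y = fun k => (ψ k Y).2) ∧ Function.Injective (eigs Y) ∧
      IsEigenframe Y fun k => (ψ k Y).1 := by
    filter_upwards [hlt, hall] with Y h1 h2
    have hsa : StrictAnti fun k => (ψ k Y).2 := fun k l hkl => h1 k l hkl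
    have heq : eigs Y = fun k => (ψ k Y).2 := by
      refine eigs_eq_of_strictAnti hsa fun k => ⟨(ψ k Y).1, fun h0 => ?_, (h2 k).1⟩
      have := (h2 k).2
      simp [h0] at this
    refine ⟨heq, heq ▸ hsa.injective, fun k l => ?_, fun k => ?_⟩
    · split_ifs with hkl
      · rw [← hkl, (h2 k).2]
      · have h3 : (gram Y *ᵥ (ψ k Y).1) ⬝ᵥ (ψ l Y).1 = (gram Y *ᵥ (ψ l Y).1) ⬝ᵥ (ψ k Y).1 := by
          rw [gram_dotProduct, gram_dotProduct, dotProduct_comm]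
        rw [(h2 k).1, (h2 l).1, smul_dotProduct, smul_dotProduct, dotProduct_comm (ψ l Y).1,
          smul_eq_mul, smul_eq_mul] at h3
        have h4 : ((ψ k Y).2 - (ψ l Y).2) * ((ψ k Y).1 ⬝ᵥ (ψ l Y).1) = 0 := by
          linear_combination h3
        exact (mul_eq_zero.1 h4).resolve_left
          (sub_ne_zero.2 fun h => hkl (hsa.injective h))
    · rw [(h2 k).1, heq]
  refine ⟨fun Y k => (ψ k Y).1, fun k i => ?_, fun k => ?_, hmain.mono fun Y h => h.2.1,
    hmain.mono fun Y h => h.2.2⟩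
  · exact contDiffAt_pi.1 (hψ k).fst i
  · exact (hψ k).snd.congr_of_eventuallyEq (hmain.mono fun Y h => congrFun h.1 k)

/-! ### Derivatives of the eigenframe -/

theorem hasDerivAt_dotProduct {m : ℕ} {f g : ℝ → Fin m → ℝ} {f' g' : Fin m → ℝ} {t : ℝ}
    (hf : ∀ j, HasDerivAt (fun s => f s j) (f' j) t)
    (hg : ∀ j, HasDerivAt (fun s => g s j) (g' j) t) :
    HasDerivAt (fun s => f s ⬝ᵥ g s) (f' ⬝ᵥ g t + f t ⬝ᵥ g') t := by
  simp only [dotProduct, ← Finset.sum_add_distrib]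
  exact HasDerivAt.fun_sum fun j _ => (hf j).mul (hg j)

theorem hasDerivAt_line_mulVec {n p : ℕ} (X E : Mat n p) {v : ℝ → Fin p → ℝ} {v' : Fin p → ℝ}
    (hv : ∀ j, HasDerivAt (fun s => v s j) (v' j) 0) (a : Fin n) :
    HasDerivAt (fun s => (Matrix.of (X + s • E) *ᵥ v s) a)
      ((Matrix.of E *ᵥ v 0 + Matrix.of X *ᵥ v') a) 0 := by
  have h := hasDerivAt_dotProduct (f := fun s => (X + s • E) a) (f' := E a) (t := 0)
    (fun j => by simpa using ((hasDerivAt_id (0 : ℝ)).mul_const (E a j)).const_add (X a j)) hv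
  rw [zero_smul, add_zero] at h
  exact h

/-- First-order perturbation theory of an orthonormal eigenframe along a line, tested against the
frame itself. -/
theorem eigenframe_deriv {n p : ℕ} {X E : Mat n p} {V : ℝ → Fin p → Fin p → ℝ}
    {V' : Fin p → Fin p → ℝ} {l' : Fin p → ℝ}
    (hV : ∀ᶠ s : ℝ in 𝓝 0, IsEigenframe (X + s • E) (V s))
    (hV' : ∀ k j, HasDerivAt (fun s => V s k j) (V' k j) 0)
    (hl' : ∀ k, HasDerivAt (fun s : ℝ => eigs (X + s • E) k) (l' k) 0) (k l : Fin p) :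
    (Matrix.of E *ᵥ V 0 k) ⬝ᵥ (Matrix.of X *ᵥ V 0 l)
        + (Matrix.of X *ᵥ V 0 k) ⬝ᵥ (Matrix.of E *ᵥ V 0 l)
      = l' k * (V 0 k ⬝ᵥ V 0 l) + (eigs X k - eigs X l) * (V' k ⬝ᵥ V 0 l) := by
  have h0 : IsEigenframe X (V 0) := by simpa using hV.self_of_nhds
  -- `⟪X v, X w⟫ = t ⟪v, w⟫` for an eigenpair `(v, t)` and a fixed vector `w`
  have heq : (fun s : ℝ => (Matrix.of (X + s • E) *ᵥ V s k) ⬝ᵥ (Matrix.of (X + s • E) *ᵥ V 0 l))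
      =ᶠ[𝓝 0] fun s => eigs (X + s • E) k * (V s k ⬝ᵥ V 0 l) := by
    filter_upwards [hV] with s hs
    rw [← gram_dotProduct, hs.eigen, smul_dotProduct, smul_eq_mul]
  have h1 := hasDerivAt_dotProduct (hasDerivAt_line_mulVec X E (hV' k))
    (hasDerivAt_line_mulVec X E (v := fun _ => V 0 l) (v' := 0)
      fun j => hasDerivAt_const (0 : ℝ) (V 0 l j))
  have h2 := (hl' k).mul (hasDerivAt_dotProduct (hV' k) (g := fun _ => V 0 l) (g' := 0)
    fun j => hasDerivAt_const (0 : ℝ) (V 0 l j))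
  have h3 := h1.unique (h2.congr_of_eventuallyEq heq)
  have h4 : (Matrix.of X *ᵥ V' k) ⬝ᵥ (Matrix.of X *ᵥ V 0 l) = eigs X l * (V' k ⬝ᵥ V 0 l) := by
    rw [dotProduct_comm, ← gram_dotProduct, h0.eigen, smul_dotProduct, smul_eq_mul,
      dotProduct_comm]
  simp only [zero_smul, add_zero, Matrix.mulVec_zero, dotProduct_zero, add_dotProduct, h4] at h3
  linear_combination h3

theorem dotProduct_deriv_eq_zero {m : ℕ} {v : ℝ → Fin m → ℝ} {v' : Fin m → ℝ}
    (hv : ∀ᶠ s in 𝓝 0, v s ⬝ᵥ v s = 1) (hv' : ∀ j, HasDerivAt (fun s => v s j) (v' j) 0) :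
    v' ⬝ᵥ v 0 = 0 := by
  have h1 := hasDerivAt_dotProduct hv' hv'
  have h2 : HasDerivAt (fun s => v s ⬝ᵥ v s) 0 0 :=
    (hasDerivAt_const (0 : ℝ) (1 : ℝ)).congr_of_eventuallyEq hv
  have h3 := h1.unique h2
  rw [dotProduct_comm (v 0)] at h3
  linarith

theorem unitMat_mulVec {n p : ℕ} (a : Fin n) (i : Fin p) (v : Fin p → ℝ) :
    Matrix.of (unitMat a i) *ᵥ v = Pi.single a (v i) := by
  ext b
  by_cases hb : b = a
  · subst hb
    simp [unitMat, Matrix.mulVec]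
  · simp [unitMat, Matrix.mulVec, Pi.single_eq_of_ne hb]

section Frame

variable {n p : ℕ} {V : Mat n p → Fin p → Fin p → ℝ} {X : Mat n p}

theorem IsSmoothFrameAt.isEigenframe (hV : IsSmoothFrameAt V X) : IsEigenframe X (V X) :=
  hV.eventually_frame.self_of_nhds

theorem IsSmoothFrameAt.injective (hV : IsSmoothFrameAt V X) : Function.Injective (eigs X) :=
  hV.eventually_injective.self_of_nhds

theorem eventually_line {P : Mat n p → Prop} (h : ∀ᶠ Y in 𝓝 X, P Y) (E : Mat n p) :
    ∀ᶠ s : ℝ in 𝓝 0, P (X + s • E) := by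
  have hc : ContinuousAt (fun s : ℝ => X + s • E) 0 := by fun_prop
  have := hc.tendsto
  rw [zero_smul, add_zero] at this
  exact this.eventually h

theorem IsSmoothFrameAt.hasLineDerivAt_vec (hV : IsSmoothFrameAt V X) (E : Mat n p) (k i : Fin p) :
    HasLineDerivAt ℝ (fun Y => V Y k i) (lineDeriv ℝ (fun Y => V Y k i) X E) X E :=
  ((hV.contDiffAt_vec k i).differentiableAt two_ne_zero).lineDifferentiableAt.hasLineDerivAt

/-- `eigenframe_deriv` in the direction of a matrix unit. -/
theorem IsSmoothFrameAt.perturbation (hV : IsSmoothFrameAt V X) (a : Fin n) (i k l : Fin p) :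
    V X k i * (Matrix.of X *ᵥ V X l) a + V X l i * (Matrix.of X *ᵥ V X k) a
      = lineDeriv ℝ (fun Y : Mat n p => eigs Y k) X (unitMat a i) * (if k = l then 1 else 0)
        + (eigs X k - eigs X l) *
          ((fun j => lineDeriv ℝ (fun Y => V Y k j) X (unitMat a i)) ⬝ᵥ V X l) := by
  have h := eigenframe_deriv (eventually_line hV.eventually_frame (unitMat a i))
    (fun k j => hV.hasLineDerivAt_vec (unitMat a i) k j)
    (fun k => ((hV.contDiffAt_eigs k).differentiableAt
      two_ne_zero).lineDifferentiableAt.hasLineDerivAt) k l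
  simp only [zero_smul, add_zero, unitMat_mulVec, single_dotProduct, dotProduct_single,
    hV.isEigenframe.orthonormal] at h
  rw [← h]
  ring

/-- The gradient of the simple eigenvalue `eigs X k` is `2 X v vᵀ` for its unit eigenvector `v`. -/
theorem IsSmoothFrameAt.hasLineDerivAt_eigs (hV : IsSmoothFrameAt V X) (a : Fin n) (i k : Fin p) :
    HasLineDerivAt ℝ (fun Y : Mat n p => eigs Y k)
      (2 * (V X k i * (Matrix.of X *ᵥ V X k) a)) X (unitMat a i) := by
  have h1 := ((hV.contDiffAt_eigs k).differentiableAt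
    two_ne_zero).lineDifferentiableAt.hasLineDerivAt (v := unitMat a i)
  have h2 := hV.perturbation a i k k
  rw [if_pos rfl, sub_self, zero_mul, mul_one, add_zero, ← two_mul] at h2
  rwa [← h2] at h1

/-- The derivative of the unit eigenvector of a simple eigenvalue, expanded in the eigenframe. -/
theorem IsSmoothFrameAt.lineDeriv_vec (hV : IsSmoothFrameAt V X) (a : Fin n) (i k j : Fin p) :
    lineDeriv ℝ (fun Y => V Y k j) X (unitMat a i) =
      ∑ l ∈ Finset.univ.erase k, (V X k i * (Matrix.of X *ᵥ V X l) a
        + V X l i * (Matrix.of X *ᵥ V X k) a) / (eigs X k - eigs X l) * V X l j := by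
  -- the derivative has no component along `V X k`, because `V Y k` is a unit vector near `X`
  have h0 : (fun j => lineDeriv ℝ (fun Y => V Y k j) X (unitMat a i)) ⬝ᵥ V X k = 0 := by
    have hone : ∀ᶠ Y in 𝓝 X, V Y k ⬝ᵥ V Y k = 1 := by
      filter_upwards [hV.eventually_frame] with Y hY
      rw [hY.orthonormal, if_pos rfl]
    have := dotProduct_deriv_eq_zero (eventually_line hone (unitMat a i))
      (fun j => hV.hasLineDerivAt_vec (unitMat a i) k j)
    simpa using this
  rw [eq_sum_of_orthonormal hV.isEigenframe.orthonormal
    (fun j => lineDeriv ℝ (fun Y => V Y k j) X (unitMat a i)) j,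
    ← Finset.add_sum_erase _ _ (Finset.mem_univ k), h0, zero_mul, zero_add]
  refine Finset.sum_congr rfl fun l hl => ?_
  have hlk : k ≠ l := (Finset.ne_of_mem_erase hl).symm
  have h1 := hV.perturbation a i k l
  rw [if_neg hlk, mul_zero, zero_add] at h1
  rw [h1, mul_div_cancel_left₀ _ (sub_ne_zero.2 fun h => hlk (hV.injective h))]

theorem IsEigenframe.image_dotProduct {W : Fin p → Fin p → ℝ} (hW : IsEigenframe X W)
    (k l : Fin p) :
    (Matrix.of X *ᵥ W k) ⬝ᵥ (Matrix.of X *ᵥ W l) = if k = l then eigs X k else 0 := by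
  rw [← gram_dotProduct, hW.eigen, smul_dotProduct, hW.orthonormal, smul_eq_mul, mul_ite, mul_one,
    mul_zero]

theorem sum_sum_mul_eq_dotProduct (x x' : Fin p → ℝ) (y y' : Fin n → ℝ) :
    ∑ a, ∑ i, (x i * x' i) * (y a * y' a) = (x ⬝ᵥ x') * (y ⬝ᵥ y') := by
  simp_rw [dotProduct, Finset.sum_mul_sum]
  exact Finset.sum_comm

/-! ### Gradient and Laplacian of a function of the eigenvalues -/

/-- The chain rule for a function of the eigenvalues. -/
theorem IsSmoothFrameAt.hasLineDerivAt_comp_eigs (hV : IsSmoothFrameAt V X)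
    {H : (Fin p → ℝ) → ℝ} (hH : DifferentiableAt ℝ H (eigs X)) (a : Fin n) (i : Fin p) :
    HasLineDerivAt ℝ (fun Y : Mat n p => H (eigs Y))
      (∑ k, pd H k (eigs X) * (2 * (V X k i * (Matrix.of X *ᵥ V X k) a))) X (unitMat a i) := by
  have h1 : HasDerivAt (fun s : ℝ => eigs (X + s • unitMat a i))
      (fun k => 2 * (V X k i * (Matrix.of X *ᵥ V X k) a)) 0 :=
    hasDerivAt_pi.2 fun k => hV.hasLineDerivAt_eigs a i k
  have h2 : HasFDerivAt H (fderiv ℝ H (eigs X)) (eigs (X + (0 : ℝ) • unitMat a i)) := by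
    simpa using hH.hasFDerivAt
  have h3 := h2.comp_hasDerivAt (0 : ℝ) h1
  refine h3.congr_deriv ((LinearMap.pi_apply_eq_sum_univ (fderiv ℝ H (eigs X)).toLinearMap
    fun k => 2 * (V X k i * (Matrix.of X *ᵥ V X k) a)).trans ?_)
  refine Finset.sum_congr rfl fun k _ => ?_
  have hk : (fun j => if k = j then (1 : ℝ) else 0) = Pi.single k 1 := by
    ext j
    simp [Pi.single_apply, eq_comm]
  rw [pd, hH.lineDeriv_eq_fderiv, smul_eq_mul, mul_comm, hk]
  rfl

theorem contDiffAt_pd {H : (Fin p → ℝ) → ℝ} {μ : Fin p → ℝ} (hH : ContDiffAt ℝ 2 H μ)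
    (k : Fin p) : ContDiffAt ℝ 1 (pd H k) μ := by
  have h1 : ContDiffAt ℝ 1 (fderiv ℝ H) μ := hH.fderiv_right (by norm_num)
  refine (h1.clm_apply (contDiffAt_const (c := Pi.single k (1 : ℝ)))).congr_of_eventuallyEq ?_
  filter_upwards [hH.eventually (by simp)] with ν hν
  exact (hν.differentiableAt two_ne_zero).lineDeriv_eq_fderiv

theorem IsSmoothFrameAt.continuousAt_eigs (hV : IsSmoothFrameAt V X) :
    ContinuousAt (eigs (n := n) (p := p)) X :=
  continuousAt_pi.2 fun k => (hV.contDiffAt_eigs k).continuousAt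

/-- The gradient of a function of the eigenvalues, near a matrix with simple eigenvalues. -/
theorem IsSmoothFrameAt.matGrad_eventuallyEq (hV : IsSmoothFrameAt V X) {H : (Fin p → ℝ) → ℝ}
    (hH : ContDiffAt ℝ 2 H (eigs X)) (a : Fin n) (i : Fin p) :
    (fun Y => matGrad (fun Z : Mat n p => H (eigs Z)) Y a i) =ᶠ[𝓝 X] fun Y =>
      ∑ k, pd H k (eigs Y) * (2 * (V Y k i * (Matrix.of Y *ᵥ V Y k) a)) := by
  filter_upwards [hV.eventually, hV.continuousAt_eigs.eventually (hH.eventually (by simp))]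
    with Y h1 h2
  exact (h1.hasLineDerivAt_comp_eigs (h2.differentiableAt two_ne_zero) a i).lineDeriv

theorem IsSmoothFrameAt.contDiffAt_matGrad (hV : IsSmoothFrameAt V X) {H : (Fin p → ℝ) → ℝ}
    (hH : ContDiffAt ℝ 2 H (eigs X)) (a : Fin n) (i : Fin p) :
    ContDiffAt ℝ 1 (fun Y => matGrad (fun Z : Mat n p => H (eigs Z)) Y a i) X := by
  refine ContDiffAt.congr_of_eventuallyEq ?_ (hV.matGrad_eventuallyEq hH a i)
  have hv : ∀ k i, ContDiffAt ℝ 1 (fun Y => V Y k i) X := fun k i =>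
    (hV.contDiffAt_vec k i).of_le (by norm_num)
  have he : ContDiffAt ℝ 1 (eigs (n := n) (p := p)) X :=
    contDiffAt_pi.2 fun k => (hV.contDiffAt_eigs k).of_le (by norm_num)
  refine ContDiffAt.sum fun k _ => ContDiffAt.mul ((contDiffAt_pd hH k).comp X he) ?_
  refine contDiffAt_const.mul ((hv k i).mul ?_)
  simp only [Matrix.mulVec, dotProduct, Matrix.of_apply]
  exact ContDiffAt.sum fun j _ => ContDiffAt.mul (by fun_prop) (hv k j)

theorem IsSmoothFrameAt.frobSq_matGrad (hV : IsSmoothFrameAt V X) {H : (Fin p → ℝ) → ℝ}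
    (hH : ContDiffAt ℝ 2 H (eigs X)) :
    frobSq (matGrad (fun Z : Mat n p => H (eigs Z)) X)
      = 4 * ∑ k, eigs X k * pd H k (eigs X) ^ 2 := by
  have h1 : ∀ a i, matGrad (fun Z : Mat n p => H (eigs Z)) X a i ^ 2 =
      ∑ k, ∑ l, 4 * (pd H k (eigs X) * pd H l (eigs X)) * ((V X k i * V X l i) *
        ((Matrix.of X *ᵥ V X k) a * (Matrix.of X *ᵥ V X l) a)) := by
    intro a i
    have h0 : matGrad (fun Z : Mat n p => H (eigs Z)) X a i = _ :=
      (hV.matGrad_eventuallyEq hH a i).self_of_nhds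
    rw [h0, sq, Finset.sum_mul_sum]
    exact Finset.sum_congr rfl fun k _ => Finset.sum_congr rfl fun l _ => by ring
  have h2 : ∀ k l, ∑ a, ∑ i, 4 * (pd H k (eigs X) * pd H l (eigs X)) * ((V X k i * V X l i) *
        ((Matrix.of X *ᵥ V X k) a * (Matrix.of X *ᵥ V X l) a)) =
      if k = l then 4 * (eigs X k * pd H k (eigs X) ^ 2) else 0 := by
    intro k l
    simp_rw [← Finset.mul_sum]
    rw [sum_sum_mul_eq_dotProduct, hV.isEigenframe.orthonormal, hV.isEigenframe.image_dotProduct]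
    split_ifs with hkl
    · subst hkl; ring
    · simp
  calc frobSq (matGrad (fun Z : Mat n p => H (eigs Z)) X)
      = ∑ a, ∑ i, ∑ k, ∑ l, 4 * (pd H k (eigs X) * pd H l (eigs X)) * ((V X k i * V X l i) *
        ((Matrix.of X *ᵥ V X k) a * (Matrix.of X *ᵥ V X l) a)) := by
        simp_rw [frobSq, h1]
    _ = ∑ k, ∑ l, ∑ a, ∑ i, 4 * (pd H k (eigs X) * pd H l (eigs X)) * ((V X k i * V X l i) *
        ((Matrix.of X *ᵥ V X k) a * (Matrix.of X *ᵥ V X l) a)) := by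
        rw [Finset.sum_congr rfl fun a _ => Finset.sum_comm, Finset.sum_comm]
        refine Finset.sum_congr rfl fun k _ => ?_
        rw [Finset.sum_congr rfl fun a _ => Finset.sum_comm, Finset.sum_comm]
    _ = _ := by
        simp_rw [h2]
        simp [Finset.mul_sum]

/-- The derivative of an entry of the gradient of a function of the eigenvalues in that entry. -/
theorem IsSmoothFrameAt.lineDeriv_matGrad (hV : IsSmoothFrameAt V X) {H : (Fin p → ℝ) → ℝ}
    (hH : ContDiffAt ℝ 2 H (eigs X)) (a : Fin n) (i : Fin p) :
    lineDeriv ℝ (fun Y => matGrad (fun Z : Mat n p => H (eigs Z)) Y a i) X (unitMat a i) =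
      ∑ k, (∑ l, 4 * pd (pd H k) l (eigs X) * ((V X l i * V X k i) *
          ((Matrix.of X *ᵥ V X l) a * (Matrix.of X *ᵥ V X k) a))
        + pd H k (eigs X) * (2 * ∑ l ∈ Finset.univ.erase k,
          (V X k i * (Matrix.of X *ᵥ V X l) a + V X l i * (Matrix.of X *ᵥ V X k) a) ^ 2
            / (eigs X k - eigs X l) + 2 * V X k i ^ 2)) := by
  rw [(hV.matGrad_eventuallyEq hH a i).lineDeriv_eq]
  refine HasLineDerivAt.lineDeriv ?_
  have hA : ∀ k, HasLineDerivAt ℝ (fun Y : Mat n p => (Matrix.of Y *ᵥ V Y k) a)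
      (V X k i + (Matrix.of X *ᵥ fun j => lineDeriv ℝ (fun Y => V Y k j) X (unitMat a i)) a) X
      (unitMat a i) := by
    intro k
    have := hasDerivAt_line_mulVec X (unitMat a i)
      (fun j => hV.hasLineDerivAt_vec (unitMat a i) k j) a
    simpa [unitMat_mulVec, HasLineDerivAt] using this
  have hP : ∀ k, HasLineDerivAt ℝ (fun Y : Mat n p => pd H k (eigs Y)) _ X (unitMat a i) := fun k =>
    hV.hasLineDerivAt_comp_eigs ((contDiffAt_pd hH k).differentiableAt one_ne_zero) a i
  have hsum := HasDerivAt.fun_sum (u := Finset.univ) fun k _ =>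
    HasDerivAt.mul (hP k)
      (((hV.hasLineDerivAt_vec (unitMat a i) k i : HasDerivAt _ _ _).mul (hA k)).const_mul 2)
  unfold HasLineDerivAt
  refine hsum.congr_deriv (Finset.sum_congr rfl fun k _ => ?_)
  simp only [Pi.mul_apply, zero_smul, add_zero]
  have hmv : (Matrix.of X *ᵥ fun j => lineDeriv ℝ (fun Y => V Y k j) X (unitMat a i)) a =
      ∑ l ∈ Finset.univ.erase k, (V X k i * (Matrix.of X *ᵥ V X l) a
        + V X l i * (Matrix.of X *ᵥ V X k) a) / (eigs X k - eigs X l)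
          * (Matrix.of X *ᵥ V X l) a := by
    simp_rw [hV.lineDeriv_vec]
    simp only [Matrix.mulVec, dotProduct, Finset.mul_sum]
    rw [Finset.sum_comm]
    exact Finset.sum_congr rfl fun l _ => Finset.sum_congr rfl fun j _ => by ring
  congr 1
  · rw [Finset.sum_mul]
    exact Finset.sum_congr rfl fun l _ => by ring
  · congr 1
    rw [hmv, hV.lineDeriv_vec, mul_add (V X k i), Finset.mul_sum, Finset.sum_mul, mul_add 2,
      mul_add 2, Finset.mul_sum, Finset.mul_sum, Finset.mul_sum, ← add_assoc, add_right_comm,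
      ← Finset.sum_add_distrib]
    · congr 1
      · exact Finset.sum_congr rfl fun l _ => by ring
      · ring

/-- The Laplacian of a function of the eigenvalues, at a matrix with simple eigenvalues. -/
theorem IsSmoothFrameAt.sum_lineDeriv_matGrad (hV : IsSmoothFrameAt V X) {H : (Fin p → ℝ) → ℝ}
    (hH : ContDiffAt ℝ 2 H (eigs X)) :
    ∑ a, ∑ i, lineDeriv ℝ (fun Y => matGrad (fun Z : Mat n p => H (eigs Z)) Y a i) X (unitMat a i) =
      ∑ k, (4 * (eigs X k * pd (pd H k) k (eigs X)) + pd H k (eigs X) *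
        (2 * ∑ l ∈ Finset.univ.erase k, (eigs X k + eigs X l) / (eigs X k - eigs X l) + 2 * n)) := by
  have hfr := hV.isEigenframe
  simp_rw [hV.lineDeriv_matGrad hH]
  rw [Finset.sum_congr rfl fun a _ => Finset.sum_comm, Finset.sum_comm]
  refine Finset.sum_congr rfl fun k _ => ?_
  simp_rw [Finset.sum_add_distrib]
  congr 1
  · rw [Finset.sum_congr rfl fun a _ => Finset.sum_comm, Finset.sum_comm]
    simp_rw [← Finset.mul_sum, sum_sum_mul_eq_dotProduct, hfr.orthonormal, hfr.image_dotProduct]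
    rw [Finset.sum_eq_single k]
    · simp; ring
    · intro l _ hl
      simp [hl]
    · simp
  · simp_rw [← Finset.mul_sum, Finset.sum_add_distrib]
    congr 2
    · simp_rw [← Finset.mul_sum]
      congr 1
      rw [Finset.sum_congr rfl fun a _ => Finset.sum_comm, Finset.sum_comm]
      refine Finset.sum_congr rfl fun l hl => ?_
      have hlk : k ≠ l := (Finset.ne_of_mem_erase hl).symm
      simp_rw [← Finset.sum_div]
      congr 1
      have h1 : ∀ (a : Fin n) (i : Fin p),
          (V X k i * (Matrix.of X *ᵥ V X l) a + V X l i * (Matrix.of X *ᵥ V X k) a) ^ 2 =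
          (V X k i * V X k i) * ((Matrix.of X *ᵥ V X l) a * (Matrix.of X *ᵥ V X l) a)
          + (V X l i * V X l i) * ((Matrix.of X *ᵥ V X k) a * (Matrix.of X *ᵥ V X k) a)
          + 2 * ((V X k i * V X l i) * ((Matrix.of X *ᵥ V X k) a * (Matrix.of X *ᵥ V X l) a)) :=
        fun a i => by ring
      simp_rw [h1, Finset.sum_add_distrib, ← Finset.mul_sum, sum_sum_mul_eq_dotProduct,
        hfr.orthonormal, hfr.image_dotProduct, if_neg hlk]
      simp [add_comm]
    · simp_rw [← Finset.mul_sum]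
      have h1 : ∑ i, V X k i ^ 2 = 1 := by
        have := hfr.orthonormal k k
        rw [if_pos rfl] at this
        rw [← this, dotProduct]
        exact Finset.sum_congr rfl fun i _ => sq _
      simp [h1]

end Frame

/-- Twice the Laplacian of a function of the eigenvalues plus its squared gradient is four times
the integrand of the risk formula. -/
theorem two_mul_sum_lineDeriv_add_frobSq {n p : ℕ} {X : Mat n p} {H : (Fin p → ℝ) → ℝ}
    (hinj : Function.Injective (eigs X)) (hH : ContDiffAt ℝ 2 H (eigs X)) :
    2 * ∑ a, ∑ i, lineDeriv ℝ (fun Y => matGrad (fun Z : Mat n p => H (eigs Z)) Y a i) X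
        (unitMat a i) + frobSq (matGrad (fun Z : Mat n p => H (eigs Z)) X)
      = 4 * (mainTerm n H (eigs X) + crossTerm H (eigs X)) := by
  obtain ⟨V, hV⟩ := exists_isSmoothFrameAt hinj
  rw [hV.sum_lineDeriv_matGrad hH, hV.frobSq_matGrad hH, mainTerm, crossTerm,
    ← Finset.sum_add_distrib, Finset.mul_sum, Finset.mul_sum, Finset.mul_sum,
    ← Finset.sum_add_distrib]
  exact Finset.sum_congr rfl fun k _ => by ring

/-- The matrices `X` such that `Xᵀ X` has distinct eigenvalues, at which `H` is `C²`. Since `C²` at a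
point means `C²` near it, this set is open. -/
def regularSet (n : ℕ) {p : ℕ} (H : (Fin p → ℝ) → ℝ) : Set (Mat n p) :=
  {X | Function.Injective (eigs X) ∧ ContDiffAt ℝ 2 H (eigs X)}

theorem isOpen_regularSet (n : ℕ) {p : ℕ} (H : (Fin p → ℝ) → ℝ) : IsOpen (regularSet n H) := by
  rw [isOpen_iff_mem_nhds]
  rintro X ⟨hinj, hH⟩
  obtain ⟨V, hV⟩ := exists_isSmoothFrameAt hinj
  filter_upwards [hV.eventually_injective,
    hV.continuousAt_eigs.eventually (hH.eventually (by simp))] with Y h1 h2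
  exact ⟨h1, h2⟩

theorem contDiffAt_matGrad {n p : ℕ} {X : Mat n p} {H : (Fin p → ℝ) → ℝ}
    (hX : X ∈ regularSet n H) (a : Fin n) (i : Fin p) :
    ContDiffAt ℝ 1 (fun Y => matGrad (fun Z : Mat n p => H (eigs Z)) Y a i) X := by
  obtain ⟨V, hV⟩ := exists_isSmoothFrameAt hX.1
  exact hV.contDiffAt_matGrad hX.2 a i

theorem crossTerm'_eq_crossTerm {p : ℕ} {μ : Fin p → ℝ} (hμ : Function.Injective μ)
    (H : (Fin p → ℝ) → ℝ) : crossTerm' H μ = crossTerm H μ := by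
  refine Finset.sum_congr rfl fun k _ => ?_
  congr 1
  have h1 : ∀ l ∈ Finset.univ.erase k,
      (μ k + μ l) / (μ k - μ l) = 2 * μ k * (1 / (μ k - μ l)) - 1 := by
    intro l hl
    have : μ k - μ l ≠ 0 := sub_ne_zero.2 fun h => Finset.ne_of_mem_erase hl (hμ h).symm
    field_simp
    ring
  rw [Finset.sum_congr rfl h1, Finset.sum_sub_distrib, ← Finset.mul_sum]
  have hp : 1 ≤ p := k.pos
  simp [Finset.card_erase_of_mem, Nat.cast_sub hp]
  ring

/-! ### The Gaussian matrix measure -/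

theorem pi_withDensity_ofReal {ι : Type*} [Fintype ι] {α : ι → Type*}
    [∀ i, MeasurableSpace (α i)] (μ : ∀ i, Measure (α i)) [∀ i, SigmaFinite (μ i)]
    {f : ∀ i, α i → ℝ} (hf : ∀ i, Integrable (f i) (μ i)) (h0 : ∀ i x, 0 ≤ f i x) :
    Measure.pi (fun i => (μ i).withDensity fun x => ENNReal.ofReal (f i x))
      = (Measure.pi μ).withDensity fun x => ENNReal.ofReal (∏ i, f i (x i)) := by
  have : ∀ i, IsFiniteMeasure ((μ i).withDensity fun x => ENNReal.ofReal (f i x)) := fun i =>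
    isFiniteMeasure_withDensity_ofReal (hf i).2
  refine Measure.pi_eq fun s hs => ?_
  rw [withDensity_apply _ (MeasurableSet.univ_pi hs), Measure.restrict_pi_pi,
    ← ofReal_integral_eq_lintegral_ofReal
      (Integrable.fintype_prod_dep fun i => (hf i).restrict)
      (Eventually.of_forall fun x => Finset.prod_nonneg fun i _ => h0 i (x i)),
    integral_fintype_prod_eq_prod, ENNReal.ofReal_prod_of_nonneg
      fun i _ => integral_nonneg fun x => h0 i x]
  refine Finset.prod_congr rfl fun i _ => ?_
  rw [withDensity_apply _ (hs i), ofReal_integral_eq_lintegral_ofReal (hf i).restrict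
    (Eventually.of_forall fun x => h0 i x)]

/-- The Lebesgue density of `gaussianMat M`. -/
noncomputable def gaussianMatPDF {n p : ℕ} (M X : Mat n p) : ℝ :=
  ∏ a, ∏ i, gaussianPDFReal (M a i) 1 (X a i)

theorem gaussianMat_eq_withDensity {n p : ℕ} (M : Mat n p) :
    gaussianMat M = volume.withDensity fun X => ENNReal.ofReal (gaussianMatPDF M X) := by
  have h1 : ∀ a, (Measure.pi fun i => gaussianReal (M a i) 1) =
      (volume : Measure (Fin p → ℝ)).withDensity fun x =>
        ENNReal.ofReal (∏ i, gaussianPDFReal (M a i) 1 (x i)) := by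
    intro a
    rw [volume_pi, ← pi_withDensity_ofReal _ (fun i => integrable_gaussianPDFReal (M a i) 1)
      fun i x => gaussianPDFReal_nonneg _ _ x]
    congr 1
    funext i
    rw [gaussianReal_of_var_ne_zero _ one_ne_zero]
    rfl
  rw [gaussianMat]
  simp_rw [h1]
  rw [pi_withDensity_ofReal]
  · rfl
  · intro a
    exact Integrable.fintype_prod fun i => integrable_gaussianPDFReal (M a i) 1
  · exact fun a x => Finset.prod_nonneg fun i _ => gaussianPDFReal_nonneg _ _ _

instance isProbabilityMeasure_gaussianMat {n p : ℕ} (M : Mat n p) :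
    IsProbabilityMeasure (gaussianMat M) := by
  unfold gaussianMat
  infer_instance

theorem gaussianMatPDF_eq {n p : ℕ} (M X : Mat n p) :
    gaussianMatPDF M X = (∏ _a : Fin n, ∏ _i : Fin p, (√(2 * Real.pi))⁻¹)
      * Real.exp (-frobSq (X - M) / 2) := by
  simp only [gaussianMatPDF, gaussianPDFReal, frobSq, NNReal.coe_one, mul_one,
    Finset.prod_mul_distrib, ← Real.exp_sum, Pi.sub_apply]
  congr 2
  simp_rw [neg_div, Finset.sum_neg_distrib, Finset.sum_div]

theorem gaussianMatPDF_nonneg {n p : ℕ} (M X : Mat n p) : 0 ≤ gaussianMatPDF M X :=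
  Finset.prod_nonneg fun _ _ => Finset.prod_nonneg fun _ _ => gaussianPDFReal_nonneg _ _ _

theorem contDiff_gaussianMatPDF {n p : ℕ} (M : Mat n p) : ContDiff ℝ ∞ (gaussianMatPDF M) := by
  have : gaussianMatPDF M = fun X => (∏ _a : Fin n, ∏ _i : Fin p, (√(2 * Real.pi))⁻¹)
      * Real.exp (-frobSq (X - M) / 2) := funext (gaussianMatPDF_eq M)
  rw [this]
  unfold frobSq
  simp only [Pi.sub_apply]
  fun_prop

theorem hasLineDerivAt_gaussianMatPDF {n p : ℕ} (M X : Mat n p) (a : Fin n) (i : Fin p) :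
    HasLineDerivAt ℝ (gaussianMatPDF M) (-(X a i - M a i) * gaussianMatPDF M X) X
      (unitMat a i) := by
  have h1 : HasDerivAt (fun s : ℝ => frobSq (X + s • unitMat a i - M)) (2 * (X a i - M a i)) 0 := by
    have h2 : HasDerivAt (fun s : ℝ => frobSq (X + s • unitMat a i - M))
        (∑ b, ∑ j, 2 * (X b j - M b j) * (unitMat a i : Mat n p) b j) 0 := by
      unfold frobSq
      refine HasDerivAt.fun_sum fun b _ => HasDerivAt.fun_sum fun j _ => ?_
      have h3 := ((((hasDerivAt_id (0 : ℝ)).mul_const ((unitMat a i : Mat n p) b j)).const_add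
        (X b j)).sub_const (M b j)).fun_pow 2
      simpa using h3
    refine h2.congr_deriv ?_
    rw [Finset.sum_eq_single a, Finset.sum_eq_single i]
    · simp [unitMat]
    · intro j _ hj; simp [unitMat, hj]
    · simp
    · intro b _ hb; simp [unitMat, hb]
    · simp
  have h2 := ((h1.neg.div_const 2).exp).const_mul
    (∏ _a : Fin n, ∏ _i : Fin p, (√(2 * Real.pi))⁻¹)
  unfold HasLineDerivAt
  simp_rw [gaussianMatPDF_eq]
  refine h2.congr_deriv ?_
  simp
  ring

theorem integral_gaussianMat {n p : ℕ} (M : Mat n p) (f : Mat n p → ℝ) :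
    ∫ X, f X ∂gaussianMat M = ∫ X, f X * gaussianMatPDF M X := by
  rw [gaussianMat_eq_withDensity, integral_withDensity_eq_integral_toReal_smul
    (contDiff_gaussianMatPDF M).continuous.measurable.ennreal_ofReal
    (Eventually.of_forall fun X => ENNReal.ofReal_lt_top)]
  simp_rw [ENNReal.toReal_ofReal (gaussianMatPDF_nonneg M _), smul_eq_mul, mul_comm]

theorem integrable_gaussianMat_iff {n p : ℕ} (M : Mat n p) (f : Mat n p → ℝ) :
    Integrable f (gaussianMat M) ↔ Integrable fun X => f X * gaussianMatPDF M X := by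
  rw [gaussianMat_eq_withDensity, integrable_withDensity_iff
    (contDiff_gaussianMatPDF M).continuous.measurable.ennreal_ofReal
    (Eventually.of_forall fun X => ENNReal.ofReal_lt_top)]
  simp_rw [ENNReal.toReal_ofReal (gaussianMatPDF_nonneg M _)]

theorem gaussianMat_absolutelyContinuous {n p : ℕ} (M : Mat n p) : gaussianMat M ≪ volume := by
  rw [gaussianMat_eq_withDensity]
  exact withDensity_absolutelyContinuous _ _

theorem integral_sub_sq_gaussianReal (m : ℝ) : ∫ x, (x - m) ^ 2 ∂gaussianReal m 1 = 1 := by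
  have h := variance_fun_id_gaussianReal (μ := m) (v := 1)
  rw [variance_eq_integral (by fun_prop), integral_id_gaussianReal] at h
  simpa using h

theorem integrable_sub_sq_gaussianReal (m : ℝ) :
    Integrable (fun x => (x - m) ^ 2) (gaussianReal m 1) :=
  ((memLp_id_gaussianReal 2).sub (memLp_const m)).integrable_sq

theorem integrable_entry_sub_sq {n p : ℕ} (M : Mat n p) (a : Fin n) (i : Fin p) :
    Integrable (fun X : Mat n p => (X a i - M a i) ^ 2) (gaussianMat M) :=
  integrable_comp_eval (μ := fun a => Measure.pi fun i => gaussianReal (M a i) 1) (i := a)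
    (f := fun r => (r i - M a i) ^ 2)
    (integrable_comp_eval (μ := fun i => gaussianReal (M a i) 1) (i := i)
      (f := fun x => (x - M a i) ^ 2) (integrable_sub_sq_gaussianReal (M a i)))

theorem integral_entry_sub_sq {n p : ℕ} (M : Mat n p) (a : Fin n) (i : Fin p) :
    ∫ X : Mat n p, (X a i - M a i) ^ 2 ∂gaussianMat M = 1 := by
  have h1 := integral_comp_eval (μ := fun a => Measure.pi fun i => gaussianReal (M a i) 1) (i := a)
    (f := fun r => (r i - M a i) ^ 2)
    (by fun_prop : Continuous fun r : Fin p → ℝ => (r i - M a i) ^ 2).aestronglyMeasurable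
  have h2 := integral_comp_eval (μ := fun i => gaussianReal (M a i) 1) (i := i)
    (f := fun x => (x - M a i) ^ 2) (by fun_prop)
  exact h1.trans (h2.trans (integral_sub_sq_gaussianReal (M a i)))

theorem integrable_frobSq_sub {n p : ℕ} (M : Mat n p) :
    Integrable (fun X : Mat n p => frobSq (X - M)) (gaussianMat M) :=
  integrable_finsetSum _ fun a _ => integrable_finsetSum _ fun i _ => integrable_entry_sub_sq M a i

theorem integral_frobSq_sub {n p : ℕ} (M : Mat n p) :
    ∫ X : Mat n p, frobSq (X - M) ∂gaussianMat M = n * p := by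
  unfold frobSq
  simp only [Pi.sub_apply]
  rw [integral_finsetSum _ fun a _ => integrable_finsetSum _ fun i _ =>
    integrable_entry_sub_sq M a i]
  simp_rw [integral_finsetSum _ fun i _ => integrable_entry_sub_sq M _ i, integral_entry_sub_sq]
  simp

/-! ### Weak derivatives and Stein's identity -/

section Weak

variable {n p : ℕ}

theorem continuous_lineDeriv {φ : Mat n p → ℝ} (hφ : ContDiff ℝ ∞ φ) (v : Mat n p) :
    Continuous fun X => lineDeriv ℝ φ X v := by
  have h1 : ∀ X, lineDeriv ℝ φ X v = fderiv ℝ φ X v := fun X =>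
    (hφ.differentiable (by simp) X).lineDeriv_eq_fderiv
  simp_rw [h1]
  exact (hφ.continuous_fderiv (by simp)).clm_apply continuous_const

theorem hasCompactSupport_lineDeriv {φ : Mat n p → ℝ} (hφ : ContDiff ℝ ∞ φ)
    (hc : HasCompactSupport φ) (v : Mat n p) :
    HasCompactSupport fun X => lineDeriv ℝ φ X v := by
  have h1 : ∀ X, lineDeriv ℝ φ X v = fderiv ℝ φ X v := fun X =>
    (hφ.differentiable (by simp) X).lineDeriv_eq_fderiv
  simp_rw [h1]
  exact hc.fderiv_apply ℝ v

/-- A weak directional derivative agrees with the classical one wherever the function is `C¹`. -/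
theorem ae_eq_lineDeriv_of_weak {f f' : Mat n p → ℝ} {U : Set (Mat n p)} (hU : IsOpen U)
    (v : Mat n p) (hf : LocallyIntegrable f) (hf' : LocallyIntegrable f')
    (hC : ∀ X ∈ U, ContDiffAt ℝ 1 f X)
    (hw : ∀ φ : Mat n p → ℝ, ContDiff ℝ ∞ φ → HasCompactSupport φ →
      ∫ X, f X * lineDeriv ℝ φ X v = - ∫ X, f' X * φ X) :
    ∀ᵐ X, X ∈ U → f' X = lineDeriv ℝ f X v := by
  have hcont : ContinuousOn (fun X => lineDeriv ℝ f X v) U := by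
    have h1 : ContinuousOn (fun X => fderiv ℝ f X v) U := fun X hX =>
      (((hC X hX).fderiv_right (m := 0) (by norm_num)).continuousAt.clm_apply
        continuousAt_const).continuousWithinAt
    exact h1.congr fun X hX => ((hC X hX).differentiableAt one_ne_zero).lineDeriv_eq_fderiv
  have hmain : ∀ᵐ X, X ∈ U → f' X - lineDeriv ℝ f X v = 0 := by
    refine hU.ae_eq_zero_of_integral_contDiff_smul_eq_zero
      ((hf'.locallyIntegrableOn U).sub (hcont.locallyIntegrableOn hU.measurableSet)) ?_
    intro φ hφ hφc hφU
    have hi1 : Integrable fun X => f' X * φ X :=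
      hf'.integrable_smul_right_of_hasCompactSupport hφ.continuous hφc
    have hi2 : Integrable fun X => lineDeriv ℝ f X v * φ X := by
      rw [← integrableOn_iff_integrable_of_support_subset (s := tsupport φ)]
      · exact ContinuousOn.integrableOn_compact hφc
          ((hcont.mono hφU).mul hφ.continuous.continuousOn)
      · exact (Function.support_mul_subset_right _ _).trans (subset_tsupport φ)
    have hi3 : Integrable fun X => f X * lineDeriv ℝ φ X v :=
      hf.integrable_smul_right_of_hasCompactSupport (continuous_lineDeriv hφ v)
        (hasCompactSupport_lineDeriv hφ hφc v)
    have hi4 : Integrable fun X => f X * φ X :=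
      hf.integrable_smul_right_of_hasCompactSupport hφ.continuous hφc
    have hparts : ∫ X, f X * lineDeriv ℝ φ X v = - ∫ X, lineDeriv ℝ f X v * φ X :=
      integral_bilinear_hasLineDerivAt_right_eq_neg_left_of_integrable
        (B := ContinuousLinearMap.mul ℝ ℝ) hi2 hi3 hi4
        (fun X hX => ((hC X (hφU hX)).differentiableAt
          one_ne_zero).lineDifferentiableAt.hasLineDerivAt)
        fun X _ => (hφ.differentiable (by simp) X).lineDifferentiableAt.hasLineDerivAt
    have h := hw φ hφ hφc
    rw [hparts, neg_inj] at h
    simp_rw [smul_eq_mul, mul_comm (φ _), sub_mul]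
    rw [integral_sub hi1 hi2, h, sub_self]
  filter_upwards [hmain] with X hX hXU
  exact sub_eq_zero.1 (hX hXU)

/-- A smooth cutoff function, equal to `1` on the ball of radius `m + 1`. -/
noncomputable def cutoff (n p m : ℕ) (X : Mat n p) : ℝ :=
  (⟨1, 2, one_pos, one_lt_two⟩ : ContDiffBump (0 : Mat n p)) (((m : ℝ) + 1)⁻¹ • X)

theorem contDiff_cutoff (m : ℕ) : ContDiff ℝ ∞ (cutoff n p m) :=
  (ContDiffBump.contDiff _).comp (contDiff_const_smul _)

theorem hasCompactSupport_cutoff (m : ℕ) : HasCompactSupport (cutoff n p m) :=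
  (ContDiffBump.hasCompactSupport _).comp_smul (inv_ne_zero (by positivity))

theorem abs_cutoff_le (m : ℕ) (X : Mat n p) : |cutoff n p m X| ≤ 1 := by
  rw [cutoff, abs_of_nonneg (ContDiffBump.nonneg _)]
  exact ContDiffBump.le_one _

theorem tendsto_inv_nat_add_one : Tendsto (fun m : ℕ => ((m : ℝ) + 1)⁻¹) atTop (𝓝 0) := by
  simpa using tendsto_one_div_add_atTop_nhds_zero_nat (𝕜 := ℝ)

theorem tendsto_cutoff (X : Mat n p) : Tendsto (fun m => cutoff n p m X) atTop (𝓝 1) := by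
  let ψ : ContDiffBump (0 : Mat n p) := ⟨1, 2, one_pos, one_lt_two⟩
  have h1 : Tendsto (fun m : ℕ => ((m : ℝ) + 1)⁻¹ • X) atTop (𝓝 0) := by
    simpa using tendsto_inv_nat_add_one.smul_const X
  have h2 : ψ 0 = 1 := ψ.one_of_mem_closedBall (Metric.mem_closedBall_self zero_le_one)
  have h3 := (ψ.continuous.tendsto 0).comp h1
  rw [h2] at h3
  exact h3

theorem exists_lineDeriv_cutoff_le (v : Mat n p) :
    ∃ C : ℝ, ∀ m X, |lineDeriv ℝ (cutoff n p m) X v| ≤ ((m : ℝ) + 1)⁻¹ * C := by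
  let ψ : ContDiffBump (0 : Mat n p) := ⟨1, 2, one_pos, one_lt_two⟩
  have hψ : ContDiff ℝ ∞ ψ := ψ.contDiff
  obtain ⟨C, hC⟩ := (continuous_lineDeriv hψ v).bounded_above_of_compact_support
    (hasCompactSupport_lineDeriv hψ ψ.hasCompactSupport v)
  refine ⟨C, fun m X => ?_⟩
  have h1 : lineDeriv ℝ (cutoff n p m) X v
      = ((m : ℝ) + 1)⁻¹ * lineDeriv ℝ ψ (((m : ℝ) + 1)⁻¹ • X) v := by
    rw [(hψ.differentiable (by simp) _).lineDeriv_eq_fderiv,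
      ((contDiff_cutoff m).differentiable (by simp) _).lineDeriv_eq_fderiv]
    have h2 := (hψ.differentiable (by simp) (((m : ℝ) + 1)⁻¹ • X)).hasFDerivAt.comp X
      ((hasFDerivAt_id X).const_smul (((m : ℝ) + 1)⁻¹))
    have h3 : HasFDerivAt (cutoff n p m) _ X := h2
    rw [h3.fderiv]
    simp
  rw [h1, abs_mul, abs_of_pos (by positivity : (0 : ℝ) < ((m : ℝ) + 1)⁻¹)]
  exact mul_le_mul_of_nonneg_left (hC _) (by positivity)

theorem tendsto_integral_mul {μ : Measure (Mat n p)} {F : Mat n p → ℝ} (hF : Integrable F μ)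
    {χ : ℕ → Mat n p → ℝ} (hχ : ∀ m, Continuous (χ m)) {C c : ℝ} (hC : ∀ m X, |χ m X| ≤ C)
    (hc : ∀ X, Tendsto (fun m => χ m X) atTop (𝓝 c)) :
    Tendsto (fun m => ∫ X, F X * χ m X ∂μ) atTop (𝓝 ((∫ X, F X ∂μ) * c)) := by
  rw [← integral_mul_const]
  refine tendsto_integral_of_dominated_convergence (fun X => |F X| * C)
    (fun m => hF.1.mul (hχ m).aestronglyMeasurable) (hF.abs.mul_const C) (fun m => ?_)
    (Eventually.of_forall fun X => (hc X).const_mul (F X))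
  refine Eventually.of_forall fun X => ?_
  rw [Real.norm_eq_abs, abs_mul]
  exact mul_le_mul_of_nonneg_left (hC m X) (abs_nonneg _)

/-- The weak derivative identity tested against a cutoff times the Gaussian density. -/
theorem weak_gaussian {f f' : Mat n p → ℝ} {M : Mat n p} {a : Fin n} {i : Fin p}
    (hw : ∀ φ : Mat n p → ℝ, ContDiff ℝ ∞ φ → HasCompactSupport φ →
      ∫ X, f X * lineDeriv ℝ φ X (unitMat a i) = - ∫ X, f' X * φ X)
    {ψ : Mat n p → ℝ} (hψ : ContDiff ℝ ∞ ψ) (hψc : HasCompactSupport ψ) :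
    ∫ X, (f X * lineDeriv ℝ ψ X (unitMat a i) - f X * (X a i - M a i) * ψ X) ∂gaussianMat M
      = - ∫ X, f' X * ψ X ∂gaussianMat M := by
  have h1 := hw (fun X => ψ X * gaussianMatPDF M X) (hψ.mul (contDiff_gaussianMatPDF M))
    hψc.mul_right
  rw [integral_gaussianMat, integral_gaussianMat]
  simp_rw [mul_assoc (f' _)]
  rw [← h1]
  congr 1
  funext X
  have h2 : HasLineDerivAt ℝ (fun X => ψ X * gaussianMatPDF M X) _ X (unitMat a i) :=
    HasDerivAt.mul
      ((hψ.differentiable (by simp) X).lineDifferentiableAt.hasLineDerivAt (v := unitMat a i))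
      (hasLineDerivAt_gaussianMatPDF M X a i)
  rw [h2.lineDeriv]
  simp
  ring

/-- **Stein's identity** for a weakly differentiable vector field that is square integrable under
the Gaussian measure and has an integrable divergence. The single partial derivatives are not
assumed integrable, so the weak derivative identity is summed before the cutoff is removed. -/
theorem stein_identity {M : Mat n p} {G D : Mat n p → Mat n p}
    (hD : ∀ a i, LocallyIntegrable fun X => D X a i)
    (hw : ∀ a i, ∀ φ : Mat n p → ℝ, ContDiff ℝ ∞ φ → HasCompactSupport φ →
      ∫ X, G X a i * lineDeriv ℝ φ X (unitMat a i) = - ∫ X, D X a i * φ X)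
    (hG1 : ∀ a i, Integrable (fun X => G X a i) (gaussianMat M))
    (hGX : ∀ a i, Integrable (fun X => G X a i * (X a i - M a i)) (gaussianMat M))
    (hdiv : Integrable (fun X => ∑ a, ∑ i, D X a i) (gaussianMat M)) :
    ∫ X, ∑ a, ∑ i, G X a i * (X a i - M a i) ∂gaussianMat M
      = ∫ X, ∑ a, ∑ i, D X a i ∂gaussianMat M := by
  have hcut : ∀ {F : Mat n p → ℝ}, Integrable F (gaussianMat M) → ∀ m,
      Integrable (fun X => F X * cutoff n p m X) (gaussianMat M) := fun hF m =>
    hF.mul_bdd (c := 1) (contDiff_cutoff m).continuous.aestronglyMeasurable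
      (Eventually.of_forall fun X => abs_cutoff_le m X)
  have hsum := integrable_finsetSum Finset.univ fun a _ =>
    integrable_finsetSum Finset.univ fun i _ => hGX a i
  have hGd : ∀ a i m, Integrable
      (fun X => G X a i * lineDeriv ℝ (cutoff n p m) X (unitMat a i)) (gaussianMat M) := by
    intro a i m
    obtain ⟨C, hC⟩ := exists_lineDeriv_cutoff_le (n := n) (p := p) (unitMat a i)
    exact (hG1 a i).mul_bdd (continuous_lineDeriv (contDiff_cutoff m) _).aestronglyMeasurable
      (Eventually.of_forall fun X => hC m X)
  have hDc : ∀ a i m, Integrable (fun X => D X a i * cutoff n p m X) (gaussianMat M) := by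
    intro a i m
    rw [integrable_gaussianMat_iff]
    simp_rw [mul_assoc]
    exact (hD a i).integrable_smul_right_of_hasCompactSupport
      ((contDiff_cutoff m).continuous.mul (contDiff_gaussianMatPDF M).continuous)
      (hasCompactSupport_cutoff m).mul_right
  have key : ∀ m : ℕ, (∑ a, ∑ i, ∫ X, G X a i * lineDeriv ℝ (cutoff n p m) X (unitMat a i)
        ∂gaussianMat M) - ∫ X, (∑ a, ∑ i, G X a i * (X a i - M a i)) * cutoff n p m X ∂gaussianMat M
      = - ∫ X, (∑ a, ∑ i, D X a i) * cutoff n p m X ∂gaussianMat M := by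
    intro m
    have h1 : ∀ a i, ∫ X, G X a i * lineDeriv ℝ (cutoff n p m) X (unitMat a i) ∂gaussianMat M
        - ∫ X, G X a i * (X a i - M a i) * cutoff n p m X ∂gaussianMat M
        = - ∫ X, D X a i * cutoff n p m X ∂gaussianMat M := by
      intro a i
      rw [← integral_sub (hGd a i m) (hcut (hGX a i) m)]
      exact weak_gaussian (hw a i) (contDiff_cutoff m) (hasCompactSupport_cutoff m)
    simp_rw [Finset.sum_mul]
    rw [integral_finsetSum _ fun a _ => integrable_finsetSum _ fun i _ => hcut (hGX a i) m,
      integral_finsetSum _ fun a _ => integrable_finsetSum _ fun i _ => hDc a i m]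
    simp_rw [integral_finsetSum _ fun i _ => hcut (hGX _ i) m,
      integral_finsetSum _ fun i _ => hDc _ i m]
    simp_rw [← Finset.sum_sub_distrib, h1, Finset.sum_neg_distrib]
  have hcont : ∀ m, Continuous (cutoff n p m) := fun m => (contDiff_cutoff m).continuous
  have l1 := tendsto_integral_mul hsum hcont abs_cutoff_le tendsto_cutoff
  have l2 := tendsto_integral_mul hdiv hcont abs_cutoff_le tendsto_cutoff
  have l3 : Tendsto (fun m : ℕ => ∑ a, ∑ i,
      ∫ X, G X a i * lineDeriv ℝ (cutoff n p m) X (unitMat a i) ∂gaussianMat M) atTop (𝓝 0) := by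
    have h1 : ∀ a i, Tendsto (fun m : ℕ =>
        ∫ X, G X a i * lineDeriv ℝ (cutoff n p m) X (unitMat a i) ∂gaussianMat M) atTop (𝓝 0) := by
      intro a i
      obtain ⟨C, hC⟩ := exists_lineDeriv_cutoff_le (n := n) (p := p) (unitMat a i)
      have hC0 : 0 ≤ C := by
        have := (abs_nonneg _).trans (hC 0 0)
        simpa using this
      have h2 := tendsto_integral_mul (hG1 a i)
        (fun m => continuous_lineDeriv (contDiff_cutoff m) (unitMat a i)) (C := C) (c := 0)
        (fun m X => (hC m X).trans (mul_le_of_le_one_left hC0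
          (inv_le_one_of_one_le₀ (by simp))))
        fun X => squeeze_zero_norm (fun m => hC m X) (by
          simpa using tendsto_inv_nat_add_one.mul_const C)
      simpa using h2
    simpa using tendsto_finsetSum Finset.univ fun a _ => tendsto_finsetSum Finset.univ
      fun i _ => h1 a i
  have l4 := tendsto_nhds_unique (l3.sub l1) (l2.neg.congr fun m => (key m).symm)
  simpa using l4

end Weak

/-! ### The risk formula -/

theorem frobSq_add_sub {n p : ℕ} (X G M : Mat n p) :
    frobSq (X + G - M) =
      frobSq (X - M) + 2 * (∑ a, ∑ i, G a i * (X a i - M a i)) + frobSq G := by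
  simp only [frobSq, Finset.mul_sum, ← Finset.sum_add_distrib, Pi.add_apply, Pi.sub_apply]
  exact Finset.sum_congr rfl fun a _ => Finset.sum_congr rfl fun i _ => by ring

theorem sq_le_frobSq {n p : ℕ} (A : Mat n p) (a : Fin n) (i : Fin p) : A a i ^ 2 ≤ frobSq A :=
  (Finset.single_le_sum (f := fun i => A a i ^ 2) (fun i _ => sq_nonneg (A a i))
    (Finset.mem_univ i)).trans
    (Finset.single_le_sum (f := fun a => ∑ i, A a i ^ 2)
      (fun a _ => Finset.sum_nonneg fun i _ => sq_nonneg (A a i)) (Finset.mem_univ a))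

/-- **Stein's unbiased risk estimate** for an estimator `X + G X` with square integrable `G`. -/
theorem integral_frobSq_add_sub {n p : ℕ} {M : Mat n p} {G D : Mat n p → Mat n p}
    (hG : ∀ a i, LocallyIntegrable fun X => G X a i)
    (hD : ∀ a i, LocallyIntegrable fun X => D X a i)
    (hw : ∀ a i, ∀ φ : Mat n p → ℝ, ContDiff ℝ ∞ φ → HasCompactSupport φ →
      ∫ X, G X a i * lineDeriv ℝ φ X (unitMat a i) = - ∫ X, D X a i * φ X)
    (hG2 : Integrable (fun X => frobSq (G X)) (gaussianMat M))
    (hdiv : Integrable (fun X => ∑ a, ∑ i, D X a i) (gaussianMat M)) :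
    Integrable (fun X => frobSq (X + G X - M)) (gaussianMat M) ∧
    ∫ X, frobSq (X + G X - M) ∂gaussianMat M
      = n * p + ∫ X, (2 * (∑ a, ∑ i, D X a i) + frobSq (G X)) ∂gaussianMat M := by
  have hmeas : ∀ a i, AEStronglyMeasurable (fun X => G X a i) (gaussianMat M) := fun a i =>
    (hG a i).aestronglyMeasurable.mono_ac (gaussianMat_absolutelyContinuous M)
  have hGL2 : ∀ a i, MemLp (fun X => G X a i) 2 (gaussianMat M) := fun a i =>
    (memLp_two_iff_integrable_sq (hmeas a i)).2 (hG2.mono' ((hmeas a i).pow 2)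
      (Eventually.of_forall fun X => by
        rw [Real.norm_eq_abs, abs_of_nonneg (sq_nonneg _)]
        exact sq_le_frobSq (G X) a i))
  have hXL2 : ∀ a i, MemLp (fun X : Mat n p => X a i - M a i) 2 (gaussianMat M) := fun a i =>
    (memLp_two_iff_integrable_sq (Continuous.aestronglyMeasurable (by fun_prop))).2
      (integrable_entry_sub_sq M a i)
  have hGX : ∀ a i, Integrable (fun X => G X a i * (X a i - M a i)) (gaussianMat M) := fun a i =>
    (hGL2 a i).integrable_mul (hXL2 a i)
  have hcross := integrable_finsetSum Finset.univ fun a _ =>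
    integrable_finsetSum Finset.univ fun i _ => hGX a i
  have hstein := stein_identity hD hw (fun a i => (hGL2 a i).integrable one_le_two) hGX hdiv
  simp_rw [frobSq_add_sub]
  have hlin : Integrable (fun X => frobSq (X - M) + 2 * ∑ a, ∑ i, G X a i * (X a i - M a i))
      (gaussianMat M) := (integrable_frobSq_sub M).add (hcross.const_mul 2)
  refine ⟨hlin.add hG2, ?_⟩
  rw [integral_add hlin hG2,
    integral_add (integrable_frobSq_sub M) (hcross.const_mul 2), integral_const_mul, hstein,
    integral_frobSq_sub, integral_add (hdiv.const_mul 2) hG2, integral_const_mul, add_assoc]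

end MatrixRisk

theorem mainTheorem2 (n p : ℕ) (hnp : p ≤ n + 1)
    (h : MatrixRisk.Mat n p → ℝ) (H : (Fin p → ℝ) → ℝ)
    (h_inv : MatrixRisk.IsOrthInvariant h)
    (h_eq : ∀ X : MatrixRisk.Mat n p, h X = H (MatrixRisk.eigs X))
    (h_reg : ∀ᵐ X : MatrixRisk.Mat n p, ContDiffAt ℝ 2 H (MatrixRisk.eigs X))
    (h_weak : ∀ (a : Fin n) (i : Fin p),
      MatrixRisk.WeaklyDifferentiable fun X => MatrixRisk.matGrad h X a i)
    (M : MatrixRisk.Mat n p)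
    (h_int : Integrable (fun X => MatrixRisk.frobSq (MatrixRisk.matGrad h X))
      (MatrixRisk.gaussianMat M))
    (h_int' : Integrable (fun X => MatrixRisk.mainTerm n H (MatrixRisk.eigs X)
      + MatrixRisk.crossTerm H (MatrixRisk.eigs X)) (MatrixRisk.gaussianMat M)) :
    Integrable (fun X => MatrixRisk.frobSq (X + MatrixRisk.matGrad h X - M))
      (MatrixRisk.gaussianMat M) ∧
    Integrable (fun X => MatrixRisk.mainTerm n H (MatrixRisk.eigs X)
      + MatrixRisk.crossTerm' H (MatrixRisk.eigs X)) (MatrixRisk.gaussianMat M) ∧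
    ∫ X, MatrixRisk.frobSq (X + MatrixRisk.matGrad h X - M) ∂MatrixRisk.gaussianMat M
      = n * p + 4 * ∫ X, (MatrixRisk.mainTerm n H (MatrixRisk.eigs X)
          + MatrixRisk.crossTerm H (MatrixRisk.eigs X)) ∂MatrixRisk.gaussianMat M ∧
    ∫ X, MatrixRisk.frobSq (X + MatrixRisk.matGrad h X - M) ∂MatrixRisk.gaussianMat M
      = n * p + 4 * ∫ X, (MatrixRisk.mainTerm n H (MatrixRisk.eigs X)
          + MatrixRisk.crossTerm' H (MatrixRisk.eigs X)) ∂MatrixRisk.gaussianMat M := by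
  open MatrixRisk in
  obtain rfl : h = fun X => H (eigs X) := funext h_eq
  have hac := gaussianMat_absolutelyContinuous M
  have hinj := ae_injective_eigs hnp
  choose D hD hw using fun a i => (h_weak a i).2 a i
  -- almost everywhere the weak divergence of the gradient is given by the eigenvalue formula
  have hDiv : ∀ᵐ X : Mat n p, 2 * (∑ a, ∑ i, D a i X) + frobSq (matGrad (fun X => H (eigs X)) X)
      = 4 * (mainTerm n H (eigs X) + crossTerm H (eigs X)) := by
    have hD' : ∀ᵐ X : Mat n p, ∀ a i, X ∈ regularSet n H →
        D a i X = lineDeriv ℝ (fun Y => matGrad (fun X => H (eigs X)) Y a i) X (unitMat a i) := by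
      simp_rw [ae_all_iff]
      exact fun a i => ae_eq_lineDeriv_of_weak (isOpen_regularSet n H) (unitMat a i)
        (h_weak a i).1 (hD a i) (fun X hX => contDiffAt_matGrad hX a i) (hw a i)
    filter_upwards [hD', hinj, h_reg] with X h1 h2 h3
    simp_rw [fun a i => h1 a i ⟨h2, h3⟩]
    exact two_mul_sum_lineDeriv_add_frobSq h2 h3
  have hcross : (fun X => mainTerm n H (eigs X) + crossTerm' H (eigs X)) =ᵐ[gaussianMat M]
      fun X => mainTerm n H (eigs X) + crossTerm H (eigs X) := by
    filter_upwards [hac.ae_le hinj] with X hX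
    rw [crossTerm'_eq_crossTerm hX]
  -- the weak divergence is half the difference of the two variables assumed integrable
  have hdiv : Integrable (fun X => ∑ a, ∑ i, D a i X) (gaussianMat M) := by
    refine (((h_int'.const_mul 4).sub h_int).const_mul (1 / 2)).congr ?_
    filter_upwards [hac.ae_le hDiv] with X hX
    simp only [Pi.sub_apply]
    linear_combination -(1 / 2) * hX
  obtain ⟨hrisk, hval⟩ := integral_frobSq_add_sub (G := matGrad fun X => H (eigs X))
    (D := fun X a i => D a i X) (fun a i => (h_weak a i).1) hD hw h_int hdiv
  rw [integral_congr_ae (hac.ae_le hDiv), integral_const_mul] at hval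
  refine ⟨hrisk, h_int'.congr hcross.symm, hval, ?_⟩
  rw [integral_congr_ae hcross]
  exact hval
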